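/- Let $V:\mathbb Z\to\mathbb R$ be a time-independent real potential with $V(n)\neq 0$ for only finitely many $n$, and let $\Delta_d f(n)=f(n+1)+f(n-1)-2f(n)$ denote the discrete Laplacian on functions $f:\mathbb Z\to\mathbb C$. Let $u\in C^1([0,\infty),\ell^2(\mathbb Z))$ be a (complex-valued) strong solution of the discrete Schrödinger equation $$\partial_t u(t,n)=i\bigl(\Delta_d u(t,n)+V(n)u(t,n)\bigr),\qquad t\ge 0,\ n\in\mathbb Z.$$ Suppose that for some $\varepsilon>0$ and some constant $C$ the one-sided bound $$|u(t,n)|\le C\left(\frac{e}{(2+\varepsilon)n}\right)^n$$ holds for all integers $n>0$ and for $t\in\{0,1\}$. Then $u(t,n)=0$ for all $t\ge 0$ and $n\in\mathbb Z$. -/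

import Mathlib

/-- The discrete Laplacian `f(n+1) + f(n-1) - 2 f(n)` on functions `ℤ → ℂ`. -/
def discreteLaplacian (f : ℤ → ℂ) (n : ℤ) : ℂ :=
  f (n + 1) + f (n - 1) - 2 * f n

/-- `u ∈ C¹([0,∞), ℓ²(ℤ))` is a strong solution of `∂ₜ u = i (Δ_d u + V u)` with real potential
`V = V(t, n)`. The time derivative is the derivative in the norm of `ℓ²(ℤ)` (one-sided at
`t = 0`); the values of `u` at negative times are irrelevant. -/
structure IsStrongSolution (V : ℝ → ℤ → ℝ) (u : ℝ → lp (fun _ : ℤ => ℂ) 2) : Prop where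
  contDiffOn : ContDiffOn ℝ 1 u (Set.Ici 0)
  equation : ∀ t : ℝ, 0 ≤ t → ∀ n : ℤ,
    derivWithin u (Set.Ici 0) t n =
      Complex.I * (discreteLaplacian (u t) n + (V t n : ℂ) * u t n)

/-! Let `e(z, n)` be the solution of the stationary equation equal to `z ^ n` to the left of the
support of the potential. Its eigenvalue is `z + z⁻¹ - 2`, so the pairing `F_t(z) = ∑ e(z, n) u(t,
n)` satisfies `F₁ = exp(i(z + z⁻¹ - 2)) F₀` (`tsum_evolution`). For `|z| ≥ 2` one has `|e(z, n)| ≤ K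
|z| ^ n` with `K` independent of `z` (`exists_jost_bound`), so the decay hypothesis makes `F₀` and
`F₁` of exponential type `a < 1/2`. The phase has type 1 along the imaginary axis, which two such
functions cannot absorb: `F₀ exp(iz/2)` decays vertically like `exp(-(1/2 - a)|Im z|)`, and
Phragmén–Lindelöf forces `F₀ = 0` for `|z| > 2` (`eq_zero_of_exp_type_lt_half`).

It remains to recover `u(0)` from this orthogonality. The left half of the pairing is a power series
in `z⁻¹`, while the right half is holomorphic for all `z ≠ 0`. Their cancellation makes the power
series entire, so `u(0)` also decays superexponentially on the left and orthogonality extends to all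
`z ≠ 0` (`left_decay_of_tsum_jost_eq_zero`). Since `z` and `z⁻¹` share an eigenvalue, `u(0)` is
orthogonal to a full basis of generalized eigenfunctions. These are polynomials in the spectral
parameter; substituting the Jacobi operator turns them into delta functions, so `u(0) = 0`
(`eq_zero_of_tsum_jost_eq_zero`). ODE uniqueness gives `u = 0`. -/

/-! ### Complex analysis: functions of small exponential type. -/

open Complex in
/-- A function of exponential type in the right half-plane that decays exponentially along vertical
directions vanishes on the positive real axis. -/
theorem eq_zero_of_vertical_exp_decay {g : ℂ → ℂ} {a δ K : ℝ} (hδ : 0 < δ)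
    (hd : DifferentiableOn ℂ g {z | 0 < z.re})
    (hb : ∀ z : ℂ, 0 < z.re → ‖g z‖ ≤ K * Real.exp (a * z.re - δ * |z.im|))
    (x : ℝ) (hx : 0 < x) : g x = 0 := by
  have hK : 0 ≤ K := by
    have := (norm_nonneg _).trans (hb 1 (by simp))
    exact nonneg_of_mul_nonneg_left this (Real.exp_pos _)
  -- Phragmén–Lindelöf for `g(z) exp(M z)` in a sector: the bound `K` does not depend on `M`, so
  -- letting `M → ∞` kills `g x`.
  have key : ∀ M : ℝ, 0 < a + M → ‖g x‖ ≤ K * Real.exp (-(M * x)) := by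
    intro M hM
    -- On the rays `arg z = ±θ` the growth `(a + M) Re z` exactly balances the decay `δ |Im z|`. The
    -- map `exp` turns the sector into the strip `|Im ζ| ≤ θ`.
    set θ : ℝ := Real.arctan ((a + M) / δ) with hθ
    have hθ0 : 0 < θ := Real.arctan_pos.2 (by positivity)
    have hθ1 : θ < Real.pi / 2 := Real.arctan_lt_pi_div_two _
    have hcos : 0 < Real.cos θ := Real.cos_pos_of_mem_Ioo ⟨by linarith, hθ1⟩
    have htan : (a + M) * Real.cos θ = δ * Real.sin θ := by
      have h1 : Real.tan θ = (a + M) / δ := Real.tan_arctan _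
      rw [Real.tan_eq_sin_div_cos] at h1
      field_simp at h1
      linarith
    have hre : ∀ ζ : ℂ, ζ.im ∈ Set.Icc (-θ) θ → 0 < (exp ζ).re := by
      intro ζ hζ
      rw [exp_re]
      exact mul_pos (Real.exp_pos _)
        (Real.cos_pos_of_mem_Ioo ⟨by linarith [hζ.1], by linarith [hζ.2]⟩)
    have hbd : ∀ ζ : ℂ, 0 < (exp ζ).re → ‖g (exp ζ) * exp (M * exp ζ)‖ ≤
        K * Real.exp ((a + M) * (exp ζ).re - δ * |(exp ζ).im|) := by
      intro ζ hζ
      rw [norm_mul, norm_exp, re_ofReal_mul]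
      calc _ ≤ K * Real.exp (a * (exp ζ).re - δ * |(exp ζ).im|) * Real.exp (M * (exp ζ).re) := by
            gcongr
            exact hb _ hζ
        _ = _ := by rw [mul_assoc, ← Real.exp_add]; ring_nf
    have hclos : closure (im ⁻¹' Set.Ioo (-θ) θ) ⊆ im ⁻¹' Set.Icc (-θ) θ :=
      closure_minimal (Set.preimage_mono Set.Ioo_subset_Icc_self)
        (isClosed_Icc.preimage continuous_im)
    have h := PhragmenLindelof.horizontal_strip (a := -θ) (b := θ) (C := K)
      (f := fun ζ => g (exp ζ) * exp (M * exp ζ)) (z := (Real.log x : ℝ)) ?_ ?_ ?_ ?_ ?_ ?_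
    · simp only [← ofReal_exp, Real.exp_log hx] at h
      rw [norm_mul, norm_exp, ← ofReal_mul, ofReal_re] at h
      rw [Real.exp_neg, ← div_eq_mul_inv, le_div_iff₀ (Real.exp_pos _)]
      exact h
    · apply DifferentiableOn.diffContOnCl
      apply DifferentiableOn.mono _ hclos
      apply DifferentiableOn.mul
      · exact hd.comp differentiable_exp.differentiableOn (fun ζ hζ => hre ζ hζ)
      · fun_prop
    -- Growth exponent 1 is admissible because the strip has width `2θ < π`.
    · refine ⟨1, ?_, a + M, ?_⟩
      · rw [lt_div_iff₀ (by linarith)]; linarith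
      · apply Asymptotics.IsBigO.of_bound K
        rw [Filter.eventually_inf_principal]
        refine Filter.Eventually.of_forall fun ζ hζ => ?_
        refine (hbd ζ (hre ζ (Set.Ioo_subset_Icc_self hζ))).trans ?_
        rw [Real.norm_of_nonneg (Real.exp_pos _).le]
        gcongr
        have h1 : (exp ζ).re ≤ Real.exp (1 * |ζ.re|) := by
          refine (re_le_norm _).trans ?_
          rw [norm_exp, one_mul]
          exact Real.exp_le_exp.2 (le_abs_self _)
        nlinarith [abs_nonneg (exp ζ).im]
    · intro ζ hζ
      refine (hbd ζ (hre ζ (by rw [hζ]; constructor <;> linarith))).trans ?_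
      have : (a + M) * (exp ζ).re - δ * |(exp ζ).im| ≤ 0 := by
        have h2 := neg_abs_le (exp ζ).im
        rw [exp_re, exp_im, hζ, Real.cos_neg, Real.sin_neg] at *
        nlinarith [Real.exp_pos ζ.re]
      calc _ ≤ K * Real.exp 0 := by gcongr
        _ = K := by simp
    · intro ζ hζ
      refine (hbd ζ (hre ζ (by rw [hζ]; constructor <;> linarith))).trans ?_
      have : (a + M) * (exp ζ).re - δ * |(exp ζ).im| ≤ 0 := by
        have h2 := le_abs_self (exp ζ).im
        rw [exp_re, exp_im, hζ] at *
        nlinarith [Real.exp_pos ζ.re]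
      calc _ ≤ K * Real.exp 0 := by gcongr
        _ = K := by simp
    · simp [hθ0.le]
    · simp [hθ0.le]
  have hlim : Filter.Tendsto (fun M : ℝ => K * Real.exp (-(M * x))) Filter.atTop (nhds 0) := by
    have : Filter.Tendsto (fun M : ℝ => Real.exp (-(M * x))) Filter.atTop (nhds 0) :=
      Real.tendsto_exp_neg_atTop_nhds_zero.comp (Filter.tendsto_id.atTop_mul_const hx)
    simpa using this.const_mul K
  have : ‖g x‖ ≤ 0 := by
    refine ge_of_tendsto hlim ?_
    filter_upwards [Filter.eventually_gt_atTop (-a)] with M hM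
    exact key M (by linarith)
  simpa using this

open Complex in
/-- Two functions of exponential type less than `1 / 2` near infinity whose quotient is
`exp (i (z + 1 / z - 2))` vanish. -/
theorem eq_zero_of_exp_type_lt_half {F₀ F₁ : ℂ → ℂ} {a K : ℝ} (ha0 : 0 ≤ a) (ha : a < 1 / 2)
    (hd : DifferentiableOn ℂ F₀ {z | 2 < ‖z‖})
    (h0 : ∀ z : ℂ, 2 < ‖z‖ → ‖F₀ z‖ ≤ K * Real.exp (a * ‖z‖))
    (h1 : ∀ z : ℂ, 2 < ‖z‖ → ‖F₁ z‖ ≤ K * Real.exp (a * ‖z‖))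
    (h : ∀ z : ℂ, 2 < ‖z‖ → F₁ z = exp (I * (z + z⁻¹ - 2)) * F₀ z) :
    ∀ z : ℂ, 2 < ‖z‖ → F₀ z = 0 := by
  have hK : 0 ≤ K := by
    have := (norm_nonneg _).trans (h0 3 (by norm_num))
    exact nonneg_of_mul_nonneg_left this (Real.exp_pos _)
  -- Above the real axis `exp(iz/2)` supplies the decay. Below it, rewriting `F₀` through `F₁` gains
  -- `exp(Im z)`, of which half survives; the constant 1 pays for `z⁻¹`.
  have hG : ∀ z : ℂ, 2 < ‖z‖ → ‖F₀ z * exp (I * z / 2)‖ ≤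
      K * Real.exp (1 + a * ‖z‖ - |z.im| / 2) := by
    intro z hz
    have hz0 : z ≠ 0 := by rintro rfl; norm_num at hz
    have e1 : (I * z / 2).re = - z.im / 2 := by
      rw [show I * z / 2 = I * z * ((1 / 2 : ℝ) : ℂ) by push_cast; ring, re_mul_ofReal, I_mul_re]
      ring
    rw [norm_mul, norm_exp, e1]
    rcases le_total 0 z.im with hy | hy
    · rw [abs_of_nonneg hy]
      calc _ ≤ K * Real.exp (a * ‖z‖) * Real.exp (- z.im / 2) := by gcongr; exact h0 z hz
        _ = K * Real.exp (a * ‖z‖ - z.im / 2) := by rw [mul_assoc, ← Real.exp_add]; ring_nf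
        _ ≤ _ := by gcongr; linarith
    · rw [abs_of_nonpos hy]
      have e2 : F₀ z = exp (-(I * (z + z⁻¹ - 2))) * F₁ z := by
        rw [h z hz, ← mul_assoc, ← exp_add]; simp
      have e3 : (-(I * (z + z⁻¹ - 2))).re = z.im + z⁻¹.im := by simp
      have e4 : z⁻¹.im ≤ 1 := by
        refine (im_le_norm _).trans ?_
        rw [norm_inv]
        exact inv_le_one_of_one_le₀ (by linarith)
      rw [e2, norm_mul, norm_exp, e3]
      calc _ ≤ Real.exp (z.im + z⁻¹.im) * (K * Real.exp (a * ‖z‖)) * Real.exp (- z.im / 2) := by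
            gcongr; exact h1 z hz
        _ = K * Real.exp (z⁻¹.im + a * ‖z‖ + z.im / 2) := by
            rw [mul_comm (Real.exp _), mul_assoc, mul_assoc, ← Real.exp_add, ← Real.exp_add]
            ring_nf
        _ ≤ _ := by gcongr ?_ * ?_; apply Real.exp_le_exp.2; linarith
  have hreal : ∀ x : ℝ, 2 < x → F₀ x = 0 := by
    intro x hx
    -- The shift by 2 places the half-plane inside the domain. Since `a‖z‖ ≤ a Re z + a|Im z|`, the
    -- vertical rate is `1/2 - a`, positive because the type is below `1/2`.
    have := eq_zero_of_vertical_exp_decay (g := fun w => F₀ (w + 2) * exp (I * (w + 2) / 2))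
      (a := a) (δ := 1 / 2 - a) (K := K * Real.exp (1 + 2 * a)) (by linarith) ?_ ?_ (x - 2)
      (by linarith)
    · simpa using this
    · apply DifferentiableOn.mul
      · refine hd.comp (by fun_prop) fun w (hw : 0 < w.re) => ?_
        refine lt_of_lt_of_le ?_ (re_le_norm _)
        simpa using hw
      · fun_prop
    · intro w hw
      have hw2 : 2 < ‖w + 2‖ := by
        refine lt_of_lt_of_le ?_ (re_le_norm _)
        simpa using hw
      refine (hG _ hw2).trans ?_
      rw [mul_assoc, ← Real.exp_add]
      have h3 : ‖w + 2‖ ≤ (w.re + 2) + |w.im| := by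
        refine (norm_le_abs_re_add_abs_im _).trans ?_
        simp only [add_re, add_im, re_ofNat, im_ofNat, add_zero]
        rw [abs_of_pos (by linarith)]
      have h4 : (w + 2).im = w.im := by simp
      rw [h4]
      gcongr
      nlinarith
  intro z hz
  have hz0 : z ≠ 0 := by rintro rfl; norm_num at hz
  -- Pulling the exterior of the disc back by `exp` gives a half-plane, whose connectedness is
  -- immediate.
  set U : Set ℂ := {ζ | Real.log 2 < ζ.re} with hU
  have hUo : IsOpen U := isOpen_lt continuous_const continuous_re
  have hUc : IsPreconnected U := (convex_halfSpace_re_gt _).isPreconnected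
  have hmaps : ∀ ζ ∈ U, 2 < ‖exp ζ‖ := by
    intro ζ hζ
    rw [norm_exp, ← Real.log_lt_iff_lt_exp (by norm_num)]
    exact hζ
  have han : AnalyticOnNhd ℂ (fun ζ => F₀ (exp ζ)) U :=
    (hd.comp differentiable_exp.differentiableOn hmaps).analyticOnNhd hUo
  have h1U : ((Real.log 3 : ℝ) : ℂ) ∈ U :=
    show Real.log 2 < ((Real.log 3 : ℝ) : ℂ).re from
      Real.log_lt_log (by norm_num) (by norm_num)
  have hfreq : ∃ᶠ ζ in nhdsWithin ((Real.log 3 : ℝ) : ℂ) {((Real.log 3 : ℝ) : ℂ)}ᶜ,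
      F₀ (exp ζ) = 0 := by
    have ht : Filter.Tendsto (fun t : ℝ => (t : ℂ)) (nhdsWithin (Real.log 3) (Set.Ioi (Real.log 3)))
        (nhdsWithin ((Real.log 3 : ℝ) : ℂ) {((Real.log 3 : ℝ) : ℂ)}ᶜ) := by
      refine tendsto_nhdsWithin_iff.2 ⟨(continuous_ofReal.tendsto _).mono_left nhdsWithin_le_nhds, ?_⟩
      filter_upwards [self_mem_nhdsWithin] with t ht
      exact fun h => ne_of_gt ht (ofReal_injective h)
    refine ht.frequently (Filter.Eventually.frequently ?_)
    filter_upwards [self_mem_nhdsWithin] with t ht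
    rw [← ofReal_exp]
    apply hreal
    rw [← Real.log_lt_iff_lt_exp (by norm_num)]
    exact lt_trans (Real.log_lt_log (by norm_num) (by norm_num)) ht
  have hz := han.eqOn_zero_of_preconnected_of_frequently_eq_zero hUc h1U hfreq
    (show log z ∈ U from
      show Real.log 2 < (log z).re by rw [log_re]; exact Real.log_lt_log (by norm_num) hz)
  simpa [exp_log hz0] using hz

/-! ### Evolution in weighted bounded sequences and pairing with eigenfunctions. -/

section

open scoped BoundedContinuousFunction
open BoundedContinuousFunction

/-- The three-term difference operator `f ↦ α(n) f(n+1) + β(n) f(n-1) + γ(n) f(n)`. -/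
noncomputable def threeTerm (α β γ : ℤ →ᵇ ℂ) : (ℤ →ᵇ ℂ) →L[ℂ] (ℤ →ᵇ ℂ) :=
  ContinuousLinearMap.mul ℂ (ℤ →ᵇ ℂ) α ∘L
      compContinuousCLM ℂ ℂ (⟨fun n => n + 1, continuous_of_discreteTopology⟩ : C(ℤ, ℤ)) +
    ContinuousLinearMap.mul ℂ (ℤ →ᵇ ℂ) β ∘L
      compContinuousCLM ℂ ℂ (⟨fun n => n - 1, continuous_of_discreteTopology⟩ : C(ℤ, ℤ)) +
    ContinuousLinearMap.mul ℂ (ℤ →ᵇ ℂ) γ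

/-- The inclusion of `ℓ²(ℤ)` in the bounded functions. -/
noncomputable def lpToBounded : lp (fun _ : ℤ => ℂ) 2 →L[ℂ] (ℤ →ᵇ ℂ) :=
  LinearMap.mkContinuous
    { toFun := fun f => ofNormedAddCommGroupDiscrete (fun n => f n) ‖f‖
        (fun n => lp.norm_apply_le_norm two_ne_zero f n)
      map_add' := fun f g => by ext; rfl
      map_smul' := fun c f => by ext; rfl } 1
    (fun f => by
      rw [norm_le (by positivity), one_mul]
      exact fun n => lp.norm_apply_le_norm two_ne_zero f n)

theorem lpToBounded_apply (f : lp (fun _ : ℤ => ℂ) 2) (n : ℤ) : lpToBounded f n = f n := rfl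

theorem hasDerivAt_exp_smul_apply (A : (ℤ →ᵇ ℂ) →L[ℂ] (ℤ →ᵇ ℂ)) (g : ℤ →ᵇ ℂ) (t : ℝ) :
    HasDerivAt (fun t : ℝ => NormedSpace.exp (t • A) g) (A (NormedSpace.exp (t • A) g)) t := by
  have h := hasDerivAt_exp_smul_const' (𝕂 := ℝ) A t
  exact (((ContinuousLinearMap.apply ℂ (ℤ →ᵇ ℂ) g).restrictScalars ℝ).hasFDerivAt.comp_hasDerivAt
    t h)

theorem exp_zero_smul_apply (A : (ℤ →ᵇ ℂ) →L[ℂ] (ℤ →ᵇ ℂ)) (g : ℤ →ᵇ ℂ) :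
    NormedSpace.exp ((0 : ℝ) • A) g = g := by
  have h : (0 : ℝ) • A = 0 := zero_smul ℝ A
  rw [h]
  simp

/-- A strong solution whose initial value is bounded relative to a slowly varying weight is given
by the exponential of the conjugated Hamiltonian on bounded functions. -/
theorem weighted_evolution {V : ℤ → ℝ} {B : ℝ} (hV : ∀ n, |V n| ≤ B)
    {u : ℝ → lp (fun _ : ℤ => ℂ) 2} (hu : IsStrongSolution (fun _ => V) u)
    {w : ℤ → ℝ} {ρ : ℝ} (hw : ∀ n, 1 ≤ w n) (hwp : ∀ n, w n ≤ ρ * w (n + 1))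
    (hwm : ∀ n, w n ≤ ρ * w (n - 1)) (g : ℤ →ᵇ ℂ) (hg : ∀ n, g n = w n * u 0 n) :
    ∃ A : (ℤ →ᵇ ℂ) →L[ℂ] (ℤ →ᵇ ℂ),
      (∀ f n, A f n = (w n / w (n + 1) : ℂ) * f (n + 1) + (w n / w (n - 1) : ℂ) * f (n - 1) +
        ((V n : ℂ) - 2) * f n) ∧
      ∀ t : ℝ, 0 ≤ t → ∀ n, w n * u t n = NormedSpace.exp (t • (Complex.I • A)) g n := by
  have hw0 : ∀ n, 0 < w n := fun n => one_pos.trans_le (hw n)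
  have hwc : ∀ n, (w n : ℂ) ≠ 0 := fun n => Complex.ofReal_ne_zero.2 (hw0 n).ne'
  have hq : ∀ n m, w n ≤ ρ * w m → ‖(w n / w m : ℂ)‖ ≤ ρ := by
    intro n m h
    rw [norm_div, Complex.norm_real, Complex.norm_real, Real.norm_of_nonneg (hw0 n).le,
      Real.norm_of_nonneg (hw0 m).le, div_le_iff₀ (hw0 m)]
    exact h
  let α : ℤ →ᵇ ℂ := ofNormedAddCommGroupDiscrete (fun n => (w n / w (n + 1) : ℂ)) ρ
    fun n => hq _ _ (hwp n)
  let β : ℤ →ᵇ ℂ := ofNormedAddCommGroupDiscrete (fun n => (w n / w (n - 1) : ℂ)) ρ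
    fun n => hq _ _ (hwm n)
  let γ : ℤ →ᵇ ℂ := ofNormedAddCommGroupDiscrete (fun n => (V n : ℂ) - 2) (B + 2) fun n => by
    refine (norm_sub_le _ _).trans ?_
    rw [Complex.norm_real, Real.norm_eq_abs]
    have := hV n
    norm_num
    linarith
  let δ : ℤ →ᵇ ℂ := ofNormedAddCommGroupDiscrete (fun n => (w n : ℂ)⁻¹) 1 fun n => by
    rw [norm_inv, Complex.norm_real, Real.norm_of_nonneg (hw0 n).le]
    exact inv_le_one_of_one_le₀ (hw n)
  set A := threeTerm α β γ with hA
  have hAf : ∀ f n, A f n = (w n / w (n + 1) : ℂ) * f (n + 1) + (w n / w (n - 1) : ℂ) * f (n - 1) +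
      ((V n : ℂ) - 2) * f n := fun f n => rfl
  refine ⟨A, hAf, ?_⟩
  set H := threeTerm 1 1 γ with hH
  have hHf : ∀ f n, H f n = 1 * f (n + 1) + 1 * f (n - 1) + ((V n : ℂ) - 2) * f n :=
    fun f n => rfl
  set D := ContinuousLinearMap.mul ℂ (ℤ →ᵇ ℂ) δ with hD
  have hDf : ∀ f n, D f n = (w n : ℂ)⁻¹ * f n := fun f n => rfl
  -- `D`, division by the weight, intertwines the conjugated operator with the original one.
  have hDA : ∀ f, D (A f) = H (D f) := by
    intro f
    ext n
    rw [hHf, hDf, hDf, hDf, hDf, hAf]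
    have h1 := hwc n
    have h2 := hwc (n + 1)
    have h3 := hwc (n - 1)
    field_simp
  intro T hT n
  -- Both curves solve `x' = iHx` in the bounded functions, where `H` is bounded, so they coincide.
  -- Hence the weighted bound at time 0 propagates to later times.
  have huniq : Set.EqOn (fun t => lpToBounded (u t))
      (fun t : ℝ => D (NormedSpace.exp (t • (Complex.I • A)) g)) (Set.Icc 0 T) := by
    refine ODE_solution_unique_of_mem_Icc_right (v := fun _ x => (Complex.I • H) x)
      (s := fun _ => Set.univ) (K := ‖Complex.I • H‖₊) ?_ ?_ ?_ (fun _ _ => trivial) ?_ ?_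
      (fun _ _ => trivial) ?_
    · exact fun t _ => (Complex.I • H).lipschitz.lipschitzOnWith
    · exact lpToBounded.continuous.comp_continuousOn
        (hu.contDiffOn.continuousOn.mono Set.Icc_subset_Ici_self)
    · intro t ht
      have hdu : HasDerivWithinAt u (derivWithin u (Set.Ici 0) t) (Set.Ici t) t :=
        (((hu.contDiffOn.differentiableOn one_ne_zero) t ht.1).hasDerivWithinAt).mono
          (Set.Ici_subset_Ici.2 ht.1)
      have := (lpToBounded.restrictScalars ℝ).hasFDerivAt.comp_hasDerivWithinAt t hdu
      refine this.congr_deriv ?_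
      ext n
      change derivWithin u (Set.Ici 0) t n = Complex.I * (H (lpToBounded (u t)) n)
      rw [hu.equation t ht.1 n, hHf]
      simp only [lpToBounded_apply, discreteLaplacian]
      ring
    · refine Continuous.continuousOn ?_
      refine D.continuous.comp ?_
      exact continuous_iff_continuousAt.2 fun t => (hasDerivAt_exp_smul_apply _ _ t).continuousAt
    · intro t ht
      have := (D.restrictScalars ℝ).hasFDerivAt.comp_hasDerivAt t
        (hasDerivAt_exp_smul_apply (Complex.I • A) g t)
      refine (this.congr_deriv ?_).hasDerivWithinAt
      change D (Complex.I • A (NormedSpace.exp (t • (Complex.I • A)) g)) = _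
      rw [map_smul, hDA]
      rfl
    · ext n
      have h1 : (w n : ℂ)⁻¹ * g n = u 0 n := by rw [hg, inv_mul_cancel_left₀ (hwc n)]
      have h2 := congrArg (fun f => (w n : ℂ)⁻¹ * f n) (exp_zero_smul_apply (Complex.I • A) g)
      exact (h2.trans h1).symm
  have := congrArg (fun f => f n) (huniq (Set.right_mem_Icc.2 hT))
  change u T n = (w n : ℂ)⁻¹ * NormedSpace.exp (T • (Complex.I • A)) g n at this
  rw [this, mul_inv_cancel_left₀ (hwc n)]

/-- A strong solution with zero initial value vanishes. -/
theorem IsStrongSolution.eq_zero {V : ℤ → ℝ} {B : ℝ} (hV : ∀ n, |V n| ≤ B)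
    {u : ℝ → lp (fun _ : ℤ => ℂ) 2} (hu : IsStrongSolution (fun _ => V) u)
    (h0 : ∀ n, u 0 n = 0) {t : ℝ} (ht : 0 ≤ t) (n : ℤ) : u t n = 0 := by
  obtain ⟨A, -, h⟩ := weighted_evolution hV hu (w := fun _ => 1) (ρ := 1) (by simp) (by simp)
    (by simp) 0 (by simp [h0])
  simpa using h t ht n

/-- Summation against an absolutely summable sequence. -/
noncomputable def summableFunctional (e : ℤ → ℂ) (he : Summable fun n => ‖e n‖) :
    (ℤ →ᵇ ℂ) →L[ℂ] ℂ :=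
  have hs : ∀ f : ℤ →ᵇ ℂ, Summable fun n => ‖e n * f n‖ := fun f =>
    Summable.of_nonneg_of_le (fun _ => norm_nonneg _)
      (fun n => by rw [norm_mul]; gcongr; exact f.norm_coe_le_norm n) (he.mul_right ‖f‖)
  LinearMap.mkContinuous
    { toFun := fun f => ∑' n, e n * f n
      map_add' := fun f g => by
        rw [← (hs f).of_norm.tsum_add (hs g).of_norm]
        simp [mul_add]
      map_smul' := fun c f => by
        rw [RingHom.id_apply, smul_eq_mul, ← tsum_mul_left]
        simp [mul_left_comm] } (∑' n, ‖e n‖)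
    (fun f => by
      refine (norm_tsum_le_tsum_norm (hs f)).trans ?_
      rw [← tsum_mul_right]
      refine Summable.tsum_le_tsum (fun n => ?_) (hs f) (he.mul_right ‖f‖)
      rw [norm_mul]; gcongr; exact f.norm_coe_le_norm n)

theorem summableFunctional_apply (e : ℤ → ℂ) (he : Summable fun n => ‖e n‖) (f : ℤ →ᵇ ℂ) :
    summableFunctional e he f = ∑' n, e n * f n := rfl

/-- Sums of a geometrically bounded sequence over `ℤ`. -/
theorem summable_int_of_geometric_bound {f : ℤ → ℂ} {K r : ℝ} (hr0 : 0 ≤ r) (hr : r < 1)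
    (hf : ∀ n, ‖f n‖ ≤ K * r ^ n.natAbs) : Summable fun n => ‖f n‖ := by
  have h := (summable_geometric_of_lt_one hr0 hr).mul_left K
  refine Summable.of_nonneg_of_le (fun _ => norm_nonneg _) hf ?_
  exact Summable.of_nat_of_neg (by simpa using h) (by simpa using h)

/-- Summation by parts, which moves the difference operator from one factor of the pairing to the
other. -/
theorem tsum_shift_add_shift {F G H : ℤ → ℂ} (hF : Summable F) (hG : Summable G)
    (hH : Summable H) :
    ∑' n, (F (n + 1) + G (n - 1) + H n) = ∑' n, (F n + G n + H n) := by
  have hF' : Summable fun n => F (n + 1) := (Equiv.addRight (1 : ℤ)).summable_iff.2 hF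
  have hG' : Summable fun n => G (n - 1) := (Equiv.subRight (1 : ℤ)).summable_iff.2 hG
  rw [(hF'.add hG').tsum_add hH, hF'.tsum_add hG', (hF.add hG).tsum_add hH, hF.tsum_add hG]
  congr 2
  · exact (Equiv.addRight (1 : ℤ)).tsum_eq F
  · exact (Equiv.subRight (1 : ℤ)).tsum_eq G

/-- Pairing a strong solution with a generalized eigenfunction: if the initial value decays
superexponentially on the right, then the evolution acts by the phase `exp (i λ t)`. -/
theorem tsum_evolution {V : ℤ → ℝ} {B : ℝ} (hV : ∀ n, |V n| ≤ B)
    {u : ℝ → lp (fun _ : ℤ => ℂ) 2} (hu : IsStrongSolution (fun _ => V) u)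
    (hdec : ∀ ρ : ℝ, 1 ≤ ρ → ∃ K, ∀ n : ℕ, ‖u 0 n‖ * ρ ^ n ≤ K)
    {e : ℤ → ℂ} {lam : ℂ} {r K : ℝ} (hr : 1 < r) (he : ∀ n, ‖e n‖ ≤ K * r ^ n)
    (hrec : ∀ n, e (n + 1) + e (n - 1) + ((V n : ℂ) - 2) * e n = lam * e n) :
    ∑' n, e n * u 1 n = Complex.exp (Complex.I * lam) * ∑' n, e n * u 0 n := by
  -- With weight `r ^ (2n)` on the right and 1 on the left, `e n / w n` is bounded by `K r ^ (-|n|)`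
  -- on both sides.
  set ρ : ℝ := r ^ 2 with hρ
  have hr0 : 0 < r := by linarith
  have hρ1 : 1 ≤ ρ := one_le_pow₀ hr.le
  have hρ0 : 0 < ρ := by positivity
  set w : ℤ → ℝ := fun n => ρ ^ n.toNat with hwdef
  have hw : ∀ n, 1 ≤ w n := fun n => one_le_pow₀ hρ1
  have hw0 : ∀ n, 0 < w n := fun n => one_pos.trans_le (hw n)
  have hwc : ∀ n, (w n : ℂ) ≠ 0 := fun n => Complex.ofReal_ne_zero.2 (hw0 n).ne'
  obtain ⟨K₀, hK₀⟩ := hdec ρ hρ1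
  have hgb : ∀ n, ‖(w n : ℂ) * u 0 n‖ ≤ max K₀ ‖u 0‖ := by
    intro n
    rw [norm_mul, Complex.norm_real, Real.norm_of_nonneg (hw0 n).le, mul_comm]
    rcases le_total 0 n with hn | hn
    · refine le_max_of_le_left ?_
      have := hK₀ n.toNat
      rwa [Int.toNat_of_nonneg hn] at this
    · refine le_max_of_le_right ?_
      simp only [hwdef, Int.toNat_of_nonpos hn, pow_zero, mul_one]
      exact lp.norm_apply_le_norm two_ne_zero _ n
  let g : ℤ →ᵇ ℂ := ofNormedAddCommGroupDiscrete (fun n => (w n : ℂ) * u 0 n) _ hgb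
  obtain ⟨A, hA, hev⟩ := weighted_evolution hV hu (w := w) (ρ := ρ) hw
    (fun n => by
      rw [← pow_succ']
      exact pow_le_pow_right₀ hρ1 (by omega))
    (fun n => by
      rw [← pow_succ']
      exact pow_le_pow_right₀ hρ1 (by omega)) g (fun n => rfl)
  have hsums : ∀ (e' : ℤ → ℂ) (K' : ℝ), (∀ n, ‖e' n‖ ≤ K' * r ^ n) →
      Summable fun n => ‖e' n / w n‖ := by
    intro e' K' he'
    have hK' : 0 ≤ K' := by simpa using (norm_nonneg _).trans (he' 0)
    refine summable_int_of_geometric_bound (K := K') (r := r⁻¹) (by positivity)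
      (inv_lt_one_of_one_lt₀ hr) fun n => ?_
    rw [norm_div, Complex.norm_real, Real.norm_of_nonneg (hw0 n).le, div_le_iff₀ (hw0 n)]
    refine (he' n).trans ?_
    rw [mul_assoc]
    gcongr
    obtain ⟨m, rfl | rfl⟩ := Int.eq_nat_or_neg n
    · simp only [hwdef, Int.toNat_natCast, Int.natAbs_natCast, zpow_natCast, hρ, inv_pow]
      rw [← pow_mul, ← div_eq_inv_mul, le_div_iff₀ (by positivity), ← pow_add]
      exact le_of_eq (by ring_nf)
    · simp [hwdef]
  have hsum := hsums e K he
  set ℓ := summableFunctional (fun n => e n / w n) hsum with hℓ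
  -- The pairing is an eigenfunctional of `A`, so along the flow it satisfies the scalar equation
  -- `φ' = iλφ`.
  have hℓA : ∀ f, ℓ (A f) = lam * ℓ f := by
    intro f
    have hs : ∀ (e' : ℤ → ℂ) (K' : ℝ), (∀ n, ‖e' n‖ ≤ K' * r ^ n) →
        Summable fun n => e' n / w n * f n := fun e' K' he' =>
      .of_norm <| .of_nonneg_of_le (fun _ => norm_nonneg _)
        (fun n => by rw [norm_mul]; gcongr; exact f.norm_coe_le_norm n)
        ((hsums e' K' he').mul_right ‖f‖)
    have h0 := hs e K he
    have h1 := hs (fun n => e (n - 1)) (K * r⁻¹) fun n => by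
      rw [mul_assoc, ← zpow_neg_one, ← zpow_add₀ hr0.ne', neg_add_eq_sub]; exact he _
    have h2 := hs (fun n => e (n + 1)) (K * r) fun n => by
      rw [mul_assoc, ← zpow_one_add₀ hr0.ne', add_comm 1]; exact he _
    have h3 : Summable fun n => ((V n : ℂ) - 2) * (e n / w n * f n) := by
      have := ((h0.mul_left lam).sub h1).sub h2
      refine this.congr fun n => ?_
      linear_combination (-(f n) / w n) * hrec n
    calc ℓ (A f) = ∑' n, (e ((n + 1) - 1) / w (n + 1) * f (n + 1) +
          e ((n - 1) + 1) / w (n - 1) * f (n - 1) + ((V n : ℂ) - 2) * (e n / w n * f n)) := by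
          refine tsum_congr fun n => ?_
          rw [hA, add_sub_cancel_right, sub_add_cancel]
          have := hwc n
          have := hwc (n + 1)
          have := hwc (n - 1)
          field_simp
      _ = ∑' n, (e (n - 1) / w n * f n + e (n + 1) / w n * f n +
            ((V n : ℂ) - 2) * (e n / w n * f n)) :=
          tsum_shift_add_shift (F := fun n => e (n - 1) / w n * f n)
            (G := fun n => e (n + 1) / w n * f n) h1 h2 h3
      _ = ∑' n, lam * (e n / w n * f n) := by
          refine tsum_congr fun n => ?_
          linear_combination (f n / w n) * hrec n
      _ = lam * ℓ f := tsum_mul_left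
  have hφ : ∀ t : ℝ, HasDerivAt (fun t : ℝ => ℓ (NormedSpace.exp (t • (Complex.I • A)) g))
      (Complex.I * lam * ℓ (NormedSpace.exp (t • (Complex.I • A)) g)) t := by
    intro t
    have := (ℓ.restrictScalars ℝ).hasFDerivAt.comp_hasDerivAt t
        (hasDerivAt_exp_smul_apply (Complex.I • A) g t)
    refine this.congr_deriv ?_
    change ℓ (Complex.I • A (NormedSpace.exp (t • (Complex.I • A)) g)) = _
    rw [map_smul, hℓA, smul_eq_mul, mul_assoc]
  have hexp : ∀ t : ℝ, HasDerivAt (fun t : ℝ => Complex.exp (-(Complex.I * lam) * t))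
      (Complex.exp (-(Complex.I * lam) * t) * -(Complex.I * lam)) t := by
    intro t
    have h1 : HasDerivAt (fun t : ℝ => -(Complex.I * lam) * (t : ℂ)) (-(Complex.I * lam)) t := by
      simpa using (Complex.ofRealCLM.hasDerivAt (x := t)).const_mul (-(Complex.I * lam))
    exact h1.cexp
  have hconst : ∀ t : ℝ, HasDerivAt (fun t : ℝ => Complex.exp (-(Complex.I * lam) * t) *
      ℓ (NormedSpace.exp (t • (Complex.I • A)) g)) 0 t := fun t =>
    ((hexp t).mul (hφ t)).congr_deriv (by ring)
  have heq := is_const_of_deriv_eq_zero (fun t => (hconst t).differentiableAt)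
    (fun t => (hconst t).deriv) 1 0
  have hval : ∀ t : ℝ, 0 ≤ t →
      ℓ (NormedSpace.exp (t • (Complex.I • A)) g) = ∑' n, e n * u t n := by
    intro t ht
    rw [hℓ, summableFunctional_apply]
    refine tsum_congr fun n => ?_
    rw [← hev t ht n]
    field_simp [hwc n]
  simp only [hval 1 zero_le_one, hval 0 le_rfl] at heq
  simp only [Complex.ofReal_one, mul_one, Complex.ofReal_zero, mul_zero, Complex.exp_zero,
    one_mul] at heq
  rw [← heq, ← mul_assoc, ← Complex.exp_add]
  simp

end

/-! ### Three-term recursions over `ℤ`. -/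

/-- The values at `0, 1, 2, …` of the solution of `s (n + 1) + s (n - 1) = ν n * s n` with
`s (-1) = a` and `s 0 = b`. -/
def recSolRight {A : Type*} [Ring A] (ν : ℤ → A) (a b : A) : ℕ → A
  | 0 => b
  | 1 => ν 0 * b - a
  | k + 2 => ν (k + 1) * recSolRight ν a b (k + 1) - recSolRight ν a b k

/-- The solution of `s (n + 1) + s (n - 1) = ν n * s n` with `s (-1) = a` and `s 0 = b`. -/
def recSol {A : Type*} [Ring A] (ν : ℤ → A) (a b : A) : ℤ → A
  | Int.ofNat k => recSolRight ν a b k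
  -- The reflection `n ↦ -1 - n` exchanges the sites 0 and -1, hence the swapped initial values.
  | Int.negSucc k => recSolRight (fun n => ν (-1 - n)) b a k

section
variable {A : Type*} [Ring A] (ν : ℤ → A) (a b : A)

theorem recSol_zero : recSol ν a b 0 = b := by
  change recSolRight ν a b 0 = b
  rw [recSolRight]

theorem recSol_neg_one : recSol ν a b (-1) = a := by
  change recSolRight (fun n => ν (-1 - n)) b a 0 = a
  rw [recSolRight]

theorem recSol_rec (n : ℤ) : recSol ν a b (n + 1) + recSol ν a b (n - 1) = ν n * recSol ν a b n := by
  match n with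
  | Int.ofNat 0 =>
    change recSolRight ν a b 1 + recSolRight (fun n => ν (-1 - n)) b a 0 =
      ν 0 * recSolRight ν a b 0
    simp [recSolRight]
  | Int.ofNat (k + 1) =>
    have h1 : Int.ofNat (k + 1) - 1 = Int.ofNat k := by simp
    have h2 : Int.ofNat (k + 1) + 1 = Int.ofNat (k + 2) := rfl
    rw [h1, h2]
    simp [recSol, recSolRight]
  | Int.negSucc 0 =>
    change recSolRight ν a b 0 + recSolRight (fun n => ν (-1 - n)) b a 1 =
      ν (-1) * recSolRight (fun n => ν (-1 - n)) b a 0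
    simp [recSolRight]
  | Int.negSucc (k + 1) =>
    have h1 : Int.negSucc (k + 1) + 1 = Int.negSucc k := by omega
    have h2 : Int.negSucc (k + 1) - 1 = Int.negSucc (k + 2) := by omega
    have h3 : (-1 - ((k : ℤ) + 1)) = Int.negSucc (k + 1) := by omega
    rw [h1, h2]
    simp [recSol, recSolRight, h3]

end

theorem int_two_step_induction {P : ℤ → Prop} (h0 : P 0) (h1 : P (-1))
    (up : ∀ n, 0 ≤ n → P (n - 1) → P n → P (n + 1))
    (down : ∀ n, n < 0 → P (n + 1) → P n → P (n - 1)) (n : ℤ) : P n := by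
  have hup : ∀ k : ℕ, P ((k : ℤ) - 1) ∧ P k := by
    intro k
    induction k with
    | zero => exact ⟨by simpa using h1, by simpa using h0⟩
    | succ k ih =>
      have := up k (by positivity) ih.1 ih.2
      exact ⟨by simpa using ih.2, by simpa using this⟩
  have hdown : ∀ k : ℕ, P (-(k : ℤ)) ∧ P (-(k : ℤ) - 1) := by
    intro k
    induction k with
    | zero => exact ⟨by simpa using h0, by simpa using h1⟩
    | succ k ih =>
      have := down (-(k : ℤ) - 1) (by omega) (by simpa using ih.1) ih.2
      refine ⟨?_, ?_⟩
      · convert ih.2 using 1; push_cast; ring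
      · convert this using 1; push_cast; ring
  obtain ⟨k, rfl | rfl⟩ := Int.eq_nat_or_neg n
  · exact (hup k).2
  · exact (hdown k).1

/-- A second-order recursion over `ℤ` is determined by two consecutive values. -/
theorem eq_of_two_step {A : Type*} [AddGroup A] {F : ℤ → A → A} {x y : ℤ → A}
    (hx : ∀ n, x (n + 1) + x (n - 1) = F n (x n)) (hy : ∀ n, y (n + 1) + y (n - 1) = F n (y n))
    (h0 : x 0 = y 0) (h1 : x (-1) = y (-1)) (n : ℤ) : x n = y n := by
  induction n using int_two_step_induction with
  | h0 => exact h0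
  | h1 => exact h1
  | up n _ ha hb =>
    have := hx n
    rw [hb, ← hy n, ha] at this
    exact add_right_cancel this
  | down n _ ha hb =>
    have := hx n
    rw [hb, ← hy n, ha] at this
    exact add_left_cancel this

/-- Each step costs at most a factor `L + 1`. The gauge `N` is left abstract so as to cover both the
norm on `ℂ` and truncated weighted coefficient sums of polynomials. -/
theorem recSol_bound {A : Type*} [Ring A] {ν : ℤ → A} {a b : A} {N : A → ℝ} {L P : ℝ}
    (hL : 0 ≤ L) (hP : 0 ≤ P) (hsub : ∀ x y, N (x - y) ≤ N x + N y)
    (hmul : ∀ n x, N (ν n * x) ≤ L * N x) (ha : N a ≤ P) (hb : N b ≤ P) (n : ℤ) :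
    N (recSol ν a b n) ≤ P * (L + 1) ^ n.natAbs := by
  have hstep : ∀ {x y : A} {n : ℤ} {i j k : ℕ}, i ≤ k → j = k → N x ≤ P * (L + 1) ^ i →
      N y ≤ P * (L + 1) ^ j → N (ν n * y - x) ≤ P * (L + 1) ^ (k + 1) := by
    intro x y n i j k hi hj hx hy
    subst hj
    have h1 : (L + 1) ^ i ≤ (L + 1) ^ j := pow_le_pow_right₀ (by linarith) hi
    calc N (ν n * y - x) ≤ L * N y + N x := (hsub _ _).trans (by gcongr; exact hmul _ _)
      _ ≤ L * (P * (L + 1) ^ j) + P * (L + 1) ^ j := by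
          gcongr
          exact hx.trans (by gcongr)
      _ = _ := by ring
  induction n using int_two_step_induction with
  | h0 => simpa [recSol_zero] using hb
  | h1 =>
    rw [recSol_neg_one]
    refine ha.trans ?_
    simp
    nlinarith
  | up n hn hx hy =>
    rw [eq_sub_of_add_eq (recSol_rec ν a b n)]
    have h2 : (n + 1).natAbs = n.natAbs + 1 := by omega
    rw [h2]
    -- At `n = 0` the neighbour -1 has larger absolute value, so the inductive bound is too weak
    -- there and the initial bound `ha` replaces it.
    rcases hn.eq_or_lt with rfl | hn
    · simp only [recSol_zero, zero_sub, recSol_neg_one]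
      exact hstep (i := 0) (j := 0) le_rfl rfl (by simpa using ha) (by simpa using hb)
    · exact hstep (by omega) rfl hx hy
  | down n hn hx hy =>
    rw [eq_sub_of_add_eq' (recSol_rec ν a b n)]
    have h2 : (n - 1).natAbs = n.natAbs + 1 := by omega
    rw [h2]
    exact hstep (by omega) rfl hx hy

/-! ### Jost solutions and their growth. -/

/-- The solution of `s (n + 1) + s (n - 1) + W n * s n = (z + z⁻¹) * s n` that continues the free
solution `z ^ n` from the left. -/
noncomputable def jost (W : ℤ → ℝ) (z : ℂ) : ℤ → ℂ :=
  recSol (fun n => z + z⁻¹ - W n) z⁻¹ 1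

theorem jost_rec (W : ℤ → ℝ) (z : ℂ) (n : ℤ) :
    jost W z (n + 1) + jost W z (n - 1) = (z + z⁻¹ - W n) * jost W z n :=
  recSol_rec _ _ _ _

theorem jost_of_nonpos {W : ℤ → ℝ} (hW : ∀ n < 0, W n = 0) {z : ℂ} (hz : z ≠ 0) {n : ℤ}
    (hn : n ≤ 0) : jost W z n = z ^ n := by
  revert hn
  induction n using int_two_step_induction with
  | h0 => intro _; simp [jost, recSol_zero]
  | h1 => intro _; simp [jost, recSol_neg_one]
  | up n h _ _ => intro h'; omega
  | down n h ha hb =>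
    intro _
    rw [eq_sub_of_add_eq' (jost_rec W z n), ha (by omega), hb (by omega), hW n h,
      zpow_add₀ hz, zpow_sub₀ hz]
    simp
    ring

theorem differentiableOn_jost (W : ℤ → ℝ) (n : ℤ) :
    DifferentiableOn ℂ (fun z => jost W z n) {z | z ≠ 0} := by
  have hinv : DifferentiableOn ℂ (fun z : ℂ => z⁻¹) {z | z ≠ 0} := fun z hz =>
    (differentiableAt_inv hz).differentiableWithinAt
  have hν : ∀ n, DifferentiableOn ℂ (fun z : ℂ => z + z⁻¹ - W n) {z | z ≠ 0} := fun n =>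
    (differentiableOn_id.add hinv).sub (differentiableOn_const _)
  induction n using int_two_step_induction with
  | h0 => simp only [jost, recSol_zero]; exact differentiableOn_const _
  | h1 => simp only [jost, recSol_neg_one]; exact hinv
  | up n _ ha hb =>
    simp only [fun z => eq_sub_of_add_eq (jost_rec W z n)]
    exact ((hν n).mul hb).sub ha
  | down n _ ha hb =>
    simp only [fun z => eq_sub_of_add_eq' (jost_rec W z n)]
    exact ((hν n).mul hb).sub ha

/-- Away from the unit disc the Jost solution is bounded by the free solution. -/
theorem exists_jost_bound {W : ℤ → ℝ} (hW : ∀ n < 0, W n = 0) {S : ℝ}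
    (hS : ∀ n : ℕ, ∑ j ∈ Finset.range n, |W j| ≤ S) :
    ∃ K, ∀ z : ℂ, 2 ≤ ‖z‖ → ∀ n, ‖jost W z n‖ ≤ K * ‖z‖ ^ n := by
  refine ⟨4 * Real.exp (2 * S), fun z hz n => ?_⟩
  have hz0 : z ≠ 0 := by rintro rfl; norm_num at hz
  have hzp : 0 < ‖z‖ := norm_pos_iff.2 hz0
  have hS0 : 0 ≤ S := by simpa using hS 0
  rcases le_total n 0 with hn | hn
  · rw [jost_of_nonpos hW hz0 hn, norm_zpow]
    have : 1 ≤ Real.exp (2 * S) := Real.one_le_exp (by positivity)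
    have h2 : 0 < ‖z‖ ^ n := zpow_pos hzp _
    nlinarith
  · lift n to ℕ using hn
    -- The potential enters through the factors `1 + 2|W j| ≤ exp(2|W j|)`, whose product is bounded
    -- independently of `z`.
    set D : ℕ → ℝ := fun n => 2 * Real.exp (2 * ∑ j ∈ Finset.range n, |W j|) with hD
    have hD0 : ∀ n, 0 < D n := fun n => by positivity
    have hDs : ∀ n : ℕ, D n * (1 + 2 * |W n|) ≤ D (n + 1) := by
      intro n
      simp only [hD, Finset.sum_range_succ]
      rw [mul_add 2 (∑ _ ∈ _, _), Real.exp_add, ← mul_assoc]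
      gcongr
      linarith [Real.add_one_le_exp (2 * |W n|)]
    -- The difference `s n - z⁻¹ s (n - 1)` obeys the first-order recursion `d (n + 1) = z d n - W n
    -- s n`, so its growth rate is exactly `|z|`, up to the potential.
    have key : ∀ n : ℕ, ‖jost W z n‖ ≤ 2 * D n * ‖z‖ ^ n ∧
        ‖jost W z n - z⁻¹ * jost W z (n - 1)‖ ≤ D n * ‖z‖ ^ n := by
      intro n
      induction n with
      | zero =>
        simp only [Nat.cast_zero, jost, recSol_zero, zero_sub, recSol_neg_one, hD]
        simp only [norm_one, Finset.range_zero, Finset.sum_empty, mul_zero, Real.exp_zero, mul_one,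
          pow_zero]
        refine ⟨by norm_num, (norm_sub_le _ _).trans ?_⟩
        have : ‖z‖⁻¹ ≤ 1 := inv_le_one_of_one_le₀ (by linarith)
        rw [norm_mul, norm_inv, norm_one]
        nlinarith [inv_pos.2 hzp]
      | succ n ih =>
        have hd : jost W z (n + 1) - z⁻¹ * jost W z n =
            z * (jost W z n - z⁻¹ * jost W z (n - 1)) - W n * jost W z n := by
          have := jost_rec W z n
          have h3 : z * (z⁻¹ * jost W z (n - 1)) = jost W z (n - 1) := mul_inv_cancel_left₀ hz0 _
          linear_combination this + h3
        have hd2 : ‖jost W z (n + 1) - z⁻¹ * jost W z n‖ ≤ D (n + 1) * ‖z‖ ^ (n + 1) := by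
          rw [hd]
          refine (norm_sub_le _ _).trans ?_
          rw [norm_mul, norm_mul, Complex.norm_real, Real.norm_eq_abs]
          calc ‖z‖ * ‖jost W z n - z⁻¹ * jost W z (n - 1)‖ + |W n| * ‖jost W z n‖
              ≤ ‖z‖ * (D n * ‖z‖ ^ n) + |W n| * (2 * D n * ‖z‖ ^ n) := by
                gcongr
                exacts [ih.2, ih.1]
            _ ≤ ‖z‖ * (D n * ‖z‖ ^ n) + |W n| * (2 * D n * ‖z‖ ^ n) * ‖z‖ := by
                refine add_le_add_right ?_ _
                exact le_mul_of_one_le_right (by have := (hD0 n).le; positivity) (by linarith)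
            _ = D n * (1 + 2 * |W n|) * ‖z‖ ^ (n + 1) := by ring
            _ ≤ _ := by gcongr; exact hDs n
        have hmono : D n ≤ D (n + 1) := by
          refine le_trans ?_ (hDs n)
          have := abs_nonneg (W n)
          nlinarith [hD0 n]
        push_cast
        rw [add_sub_cancel_right]
        refine ⟨?_, hd2⟩
        calc ‖jost W z (n + 1)‖
            = ‖(jost W z (n + 1) - z⁻¹ * jost W z n) + z⁻¹ * jost W z n‖ := by ring_nf
          _ ≤ D (n + 1) * ‖z‖ ^ (n + 1) + ‖z‖⁻¹ * (2 * D n * ‖z‖ ^ n) := by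
              refine (norm_add_le _ _).trans ?_
              rw [norm_mul z⁻¹, norm_inv]
              gcongr
              exact ih.1
          _ ≤ D (n + 1) * ‖z‖ ^ (n + 1) + D (n + 1) * ‖z‖ ^ (n + 1) := by
              refine add_le_add_right ?_ _
              rw [← div_eq_inv_mul, div_le_iff₀ hzp]
              have h5 : 0 < ‖z‖ ^ n := by positivity
              have h6 : 4 ≤ ‖z‖ * ‖z‖ := by nlinarith
              calc 2 * D n * ‖z‖ ^ n ≤ 4 * D (n + 1) * ‖z‖ ^ n := by
                    gcongr
                    norm_num
                _ ≤ (‖z‖ * ‖z‖) * D (n + 1) * ‖z‖ ^ n := by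
                    have := (hD0 (n + 1)).le
                    gcongr
                _ = _ := by ring
          _ = _ := by ring
    refine (key n).1.trans ?_
    rw [zpow_natCast]
    simp only [hD, ← mul_assoc]
    gcongr
    · norm_num
    · exact hS n

/-- The `n`-th power of `e t ≤ exp t` at `t = y / n`. -/
theorem exp_one_mul_div_pow_le (y : ℝ) (hy : 0 ≤ y) {n : ℕ} (hn : 0 < n) :
    (Real.exp 1 * y / n) ^ n ≤ Real.exp y := by
  have hn' : (0 : ℝ) < n := by exact_mod_cast hn
  have h1 : Real.exp 1 * y / n ≤ Real.exp (y / n) := by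
    have h2 : y / n ≤ Real.exp (y / n - 1) := by linarith [Real.add_one_le_exp (y / n - 1)]
    rw [Real.exp_sub, le_div_iff₀ (Real.exp_pos 1)] at h2
    linarith [show Real.exp 1 * y / n = y / n * Real.exp 1 by ring]
  calc (Real.exp 1 * y / n) ^ n ≤ Real.exp (y / n) ^ n := by gcongr
    _ = Real.exp y := by rw [← Real.exp_nat_mul]; congr 1; field_simp

/-- A bounded sequence decaying like `(e / ((2 + ε) n)) ^ n` on the right has a generating function
of exponential type less than `1 / 2`. -/
theorem exists_type_lt_half {ε : ℝ} (hε : 0 < ε) : ∃ a q : ℝ, 0 ≤ a ∧ a < 1 / 2 ∧ 0 ≤ q ∧ q < 1 ∧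
    ∀ (f : ℤ → ℂ) (B C : ℝ), (∀ n, ‖f n‖ ≤ B) → (∀ n : ℕ, 0 < n →
      ‖f n‖ ≤ C * (Real.exp 1 / ((2 + ε) * (n : ℝ))) ^ n) →
    ∀ r : ℝ, 2 ≤ r → ∀ n : ℤ, ‖f n‖ * r ^ n ≤ (|C| + B) * q ^ n.natAbs * Real.exp (a * r) := by
  -- The slack `ε` is split: `1/(2 + ε) = q₀ · 1/(2 + ε/2)`. The second factor gives the type, and
  -- `q₀` leaves a geometric factor for summation. For negative `n` the ratio `1/2` comes from `r ≥
  -- 2`.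
  set q₀ : ℝ := (2 + ε / 2) / (2 + ε) with hq₀
  have hq₀1 : q₀ < 1 := by rw [hq₀, div_lt_one (by linarith)]; linarith
  have hq₀0 : 0 < q₀ := by positivity
  refine ⟨1 / (2 + ε / 2), max q₀ (1 / 2), by positivity, ?_, by positivity,
    max_lt hq₀1 (by norm_num), ?_⟩
  · apply one_div_lt_one_div_of_lt <;> linarith
  intro f B C hB hC r hr n
  have hB0 : 0 ≤ B := (norm_nonneg _).trans (hB 0)
  have he : 1 ≤ Real.exp (1 / (2 + ε / 2) * r) := Real.one_le_exp (by positivity)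
  rcases lt_or_ge 0 n with hn | hn
  · lift n to ℕ using hn.le
    have hn' : 0 < n := by exact_mod_cast hn
    have hnr : (0 : ℝ) < n := by exact_mod_cast hn
    rw [zpow_natCast, Int.natAbs_natCast]
    calc ‖f n‖ * r ^ n ≤ |C| * (Real.exp 1 / ((2 + ε) * (n : ℝ))) ^ n * r ^ n := by
          gcongr
          refine (hC n hn').trans ?_
          gcongr
          exact le_abs_self C
      _ = |C| * (q₀ ^ n * (Real.exp 1 * (1 / (2 + ε / 2) * r) / n) ^ n) := by
          rw [mul_assoc, ← mul_pow, ← mul_pow, hq₀]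
          congr 2
          field_simp
      _ ≤ (|C| + B) * (max q₀ (1 / 2) ^ n * Real.exp (1 / (2 + ε / 2) * r)) := by
          gcongr
          · linarith
          · exact le_max_left _ _
          · exact exp_one_mul_div_pow_le _ (by positivity) hn'
      _ = _ := by ring
  · obtain ⟨m, rfl⟩ := Int.exists_eq_neg_ofNat hn
    rw [zpow_neg, zpow_natCast, Int.natAbs_neg, Int.natAbs_natCast, ← inv_pow]
    calc ‖f (-m)‖ * r⁻¹ ^ m ≤ B * max q₀ (1 / 2) ^ m := by
          gcongr
          · exact hB _
          · refine le_max_of_le_right ?_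
            rw [← one_div]
            exact one_div_le_one_div_of_le (by norm_num) hr
      _ ≤ (|C| + B) * max q₀ (1 / 2) ^ m := by
          gcongr
          linarith [abs_nonneg C]
      _ ≤ _ := le_mul_of_one_le_right (by positivity) he

/-- If a strong solution decays fast on the right at two times, then its initial value is orthogonal
to all left Jost solutions outside a disc. -/
theorem tsum_jost_mul_eq_zero {V : ℤ → ℝ} {M : ℤ} (hV : ∀ n < M, V n = 0) {S : ℝ}
    (hS : ∀ n : ℕ, ∑ j ∈ Finset.range n, |V (j + M)| ≤ S) {B : ℝ} (hVB : ∀ n, |V n| ≤ B)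
    {u : ℝ → lp (fun _ : ℤ => ℂ) 2} (hu : IsStrongSolution (fun _ => V) u)
    {ε : ℝ} (hε : 0 < ε) {C : ℝ}
    (hdecay : ∀ t ∈ ({0, 1} : Set ℝ), ∀ n : ℕ, 0 < n →
      ‖u t (n : ℤ)‖ ≤ C * (Real.exp 1 / ((2 + ε) * (n : ℝ))) ^ n) (z : ℂ) (hz : 2 < ‖z‖) :
    ∑' n, jost (fun j => V (j + M)) z (n - M) * u 0 n = 0 := by
  obtain ⟨a, q, ha0, ha, hq0, hq1, haq⟩ := exists_type_lt_half hε
  obtain ⟨K, hK⟩ := exists_jost_bound (W := fun j => V (j + M)) (fun n hn => hV _ (by omega)) hS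
  have hK0 : 0 ≤ K := by simpa using (norm_nonneg _).trans (hK 2 (by norm_num) 0)
  -- The factor `z ^ M` undoes the translation: it normalizes `e z n` to `z ^ n` left of the support
  -- and keeps the bound free of `M`.
  set e : ℂ → ℤ → ℂ := fun z n => z ^ M * jost (fun j => V (j + M)) z (n - M) with he
  have heb : ∀ z : ℂ, 2 ≤ ‖z‖ → ∀ n, ‖e z n‖ ≤ K * ‖z‖ ^ n := by
    intro z hz n
    have hz0 : ‖z‖ ≠ 0 := by linarith
    calc ‖e z n‖ ≤ ‖z‖ ^ M * (K * ‖z‖ ^ (n - M)) := by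
          rw [he, norm_mul, norm_zpow]
          gcongr
          exact hK z hz _
      _ = K * ‖z‖ ^ n := by
          rw [zpow_sub₀ hz0]
          field_simp
  have herec : ∀ z : ℂ, ∀ n, e z (n + 1) + e z (n - 1) + ((V n : ℂ) - 2) * e z n =
      (z + z⁻¹ - 2) * e z n := by
    intro z n
    have := jost_rec (fun j => V (j + M)) z (n - M)
    simp only [sub_add_cancel] at this
    simp only [he]
    rw [show n + 1 - M = n - M + 1 by ring, show n - 1 - M = n - M - 1 by ring]
    linear_combination z ^ M * this
  set Q : ℝ := max (|C| + ‖u 0‖) (|C| + ‖u 1‖) with hQ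
  have hQ0 : 0 ≤ Q := le_max_of_le_left (by positivity)
  have hub : ∀ t ∈ ({0, 1} : Set ℝ), ∀ r : ℝ, 2 ≤ r → ∀ n : ℤ,
      ‖u t n‖ * r ^ n ≤ Q * q ^ n.natAbs * Real.exp (a * r) := by
    intro t ht r hr n
    refine (haq (fun n => u t n) ‖u t‖ C (fun n => lp.norm_apply_le_norm two_ne_zero _ n)
      (hdecay t ht) r hr n).trans ?_
    gcongr
    rcases ht with rfl | rfl
    · exact le_max_left _ _
    · exact le_max_right _ _
  have hterm : ∀ t ∈ ({0, 1} : Set ℝ), ∀ z : ℂ, 2 ≤ ‖z‖ → ∀ n : ℤ,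
      ‖e z n * u t n‖ ≤ K * Q * Real.exp (a * ‖z‖) * q ^ n.natAbs := by
    intro t ht z hz n
    rw [norm_mul]
    calc ‖e z n‖ * ‖u t n‖ ≤ K * ‖z‖ ^ n * ‖u t n‖ := by gcongr; exact heb z hz n
      _ = K * (‖u t n‖ * ‖z‖ ^ n) := by ring
      _ ≤ K * (Q * q ^ n.natAbs * Real.exp (a * ‖z‖)) := mul_le_mul_of_nonneg_left (hub t ht _ hz n) hK0
      _ = _ := by ring
  have hqs : Summable fun n : ℤ => q ^ n.natAbs :=
    Summable.of_nat_of_neg (by simpa using summable_geometric_of_lt_one hq0 hq1)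
      (by simpa using summable_geometric_of_lt_one hq0 hq1)
  have hbound : ∀ t ∈ ({0, 1} : Set ℝ), ∀ z : ℂ, 2 < ‖z‖ →
      ‖∑' n, e z n * u t n‖ ≤ (K * Q * ∑' n : ℤ, q ^ n.natAbs) * Real.exp (a * ‖z‖) := by
    intro t ht z hz
    refine (tsum_of_norm_bounded (hqs.mul_left (K * Q * Real.exp (a * ‖z‖))).hasSum
      (hterm t ht z hz.le)).trans (le_of_eq ?_)
    rw [tsum_mul_left]
    ring
  have hzero := eq_zero_of_exp_type_lt_half (F₀ := fun z => ∑' n, e z n * u 0 n)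
    (F₁ := fun z => ∑' n, e z n * u 1 n) ha0 ha ?_ (hbound 0 (by simp)) (hbound 1 (by simp)) ?_ z hz
  · simp only [he, mul_assoc, tsum_mul_left] at hzero
    have hz0 : z ≠ 0 := by rintro rfl; norm_num at hz
    exact (mul_eq_zero.1 hzero).resolve_left (zpow_ne_zero _ hz0)
  · intro z₀ hz₀
    have hU : IsOpen {z : ℂ | 2 < ‖z‖ ∧ ‖z‖ < ‖z₀‖ + 1} :=
      (isOpen_lt continuous_const continuous_norm).inter
        (isOpen_lt continuous_norm continuous_const)
    have := Complex.differentiableOn_tsum_of_summable_norm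
      (F := fun (n : ℤ) z => e z n * u 0 n) (U := {z : ℂ | 2 < ‖z‖ ∧ ‖z‖ < ‖z₀‖ + 1})
      (hqs.mul_left (K * Q * Real.exp (a * (‖z₀‖ + 1)))) ?_ hU ?_
    · exact (this.differentiableAt (hU.mem_nhds ⟨hz₀, by linarith⟩)).differentiableWithinAt
    · intro n
      have hne : ∀ z ∈ {z : ℂ | 2 < ‖z‖ ∧ ‖z‖ < ‖z₀‖ + 1}, z ≠ 0 := by
        rintro z ⟨hz, -⟩ rfl
        norm_num at hz
      refine DifferentiableOn.mul_const (DifferentiableOn.mul ?_ ?_) _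
      · exact fun z hz => (differentiableAt_zpow.2 (Or.inl (hne z hz))).differentiableWithinAt
      · exact (differentiableOn_jost _ _).mono hne
    · intro n z hz
      refine (hterm 0 (by simp) z hz.1.le n).trans ?_
      gcongr
      exact hz.2.le
  · intro z hz
    refine tsum_evolution hVB hu (fun ρ hρ => ⟨Q * Real.exp (a * max ρ 2), fun n => ?_⟩)
      (by linarith : 1 < ‖z‖) (heb z hz.le) (herec z)
    have := hub 0 (by simp) (max ρ 2) (le_max_right _ _) n
    rw [zpow_natCast] at this
    calc ‖u 0 n‖ * ρ ^ n ≤ ‖u 0 n‖ * max ρ 2 ^ n := by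
          gcongr
          exact le_max_left _ _
      _ ≤ Q * q ^ (n : ℤ).natAbs * Real.exp (a * max ρ 2) := this
      _ ≤ Q * 1 * Real.exp (a * max ρ 2) := by
          gcongr
          exact pow_le_one₀ hq0 hq1.le
      _ = _ := by ring

/-! ### From orthogonality near infinity to decay on the left. -/

theorem eq_zero_of_hasSum_pow_zero {a : ℕ → ℂ} {r : ℝ} (hr : 0 < r)
    (h : ∀ w : ℂ, ‖w‖ < r → HasSum (fun n => a n * w ^ n) 0) (n : ℕ) : a n = 0 := by
  have h1 : HasFPowerSeriesAt (0 : ℂ → ℂ) (FormalMultilinearSeries.ofScalars ℂ a) 0 := by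
    rw [hasFPowerSeriesAt_iff]
    filter_upwards [Metric.ball_mem_nhds (0 : ℂ) hr] with w hw
    simpa [FormalMultilinearSeries.coeff_ofScalars, mul_comm] using h w (by simpa using hw)
  rw [← FormalMultilinearSeries.coeff_ofScalars (𝕜 := ℂ) (p := a) (n := n), h1.eq_zero]
  rfl

/-- Cruder than `exists_jost_bound`, but valid on whole annuli around 0; superexponential decay
absorbs any geometric base. -/
theorem norm_jost_le {W : ℤ → ℝ} {B R : ℝ} (hB : ∀ n, |W n| ≤ B) (hR : 1 ≤ R) {z : ℂ}
    (hz : ‖z‖ ≤ R) (hz' : ‖z⁻¹‖ ≤ R) (n : ℤ) :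
    ‖jost W z n‖ ≤ R * (2 * R + B + 1) ^ n.natAbs := by
  have hB0 : 0 ≤ B := (abs_nonneg _).trans (hB 0)
  refine recSol_bound (N := fun x : ℂ => ‖x‖) (by positivity) (by positivity) norm_sub_le ?_ hz'
    (by simpa using hR) n
  intro n x
  rw [norm_mul]
  gcongr
  calc ‖z + z⁻¹ - W n‖ ≤ ‖z‖ + ‖z⁻¹‖ + ‖(W n : ℂ)‖ :=
        (norm_sub_le _ _).trans (by gcongr; exact norm_add_le _ _)
    _ ≤ R + R + B := by
        rw [Complex.norm_real]
        gcongr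
        exact hB n
    _ = 2 * R + B := by ring

/-- Orthogonality to the left Jost solutions near infinity of a sequence decaying superexponentially
on the right forces superexponential decay on the left, and orthogonality everywhere. -/
theorem left_decay_of_tsum_jost_eq_zero {W : ℤ → ℝ} {f : ℤ → ℂ} {B P : ℝ}
    (hW : ∀ n < 0, W n = 0) (hB : ∀ n, |W n| ≤ B) (hf : ∀ n, ‖f n‖ ≤ P)
    (hright : ∀ R : ℝ, 1 ≤ R → Summable fun n : ℕ => ‖f n‖ * R ^ n)
    (h : ∀ z : ℂ, 2 < ‖z‖ → ∑' n, jost W z n * f n = 0) :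
    (∀ R : ℝ, 1 ≤ R → Summable fun n : ℕ => ‖f (-n)‖ * R ^ n) ∧
      ∀ z : ℂ, z ≠ 0 → ∑' n, jost W z n * f n = 0 := by
  have hB0 : 0 ≤ B := (abs_nonneg _).trans (hB 0)
  have hP0 : 0 ≤ P := (norm_nonneg _).trans (hf 0)
  set g : ℂ → ℂ := fun z => ∑' n : ℕ, jost W z (n + 1) * f (n + 1) with hg
  set L : ℂ → ℂ := fun w => ∑' n : ℕ, f (-n) * w ^ n with hL
  have hterm : ∀ R : ℝ, 1 ≤ R → Summable (fun n : ℕ => R * (2 * R + B + 1) ^ (n + 1) *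
      ‖f ((n : ℤ) + 1)‖) ∧ ∀ z : ℂ, ‖z‖ ≤ R → ‖z⁻¹‖ ≤ R → ∀ n : ℕ,
        ‖jost W z (n + 1) * f (n + 1)‖ ≤ R * (2 * R + B + 1) ^ (n + 1) * ‖f ((n : ℤ) + 1)‖ := by
    intro R hR
    constructor
    · have := ((summable_nat_add_iff 1).2 (hright (2 * R + B + 1) (by linarith))).mul_left R
      refine this.congr fun n => ?_
      push_cast
      ring
    · intro z hz hz' n
      rw [norm_mul]
      gcongr
      exact norm_jost_le hB hR hz hz' _
  have hgd : ∀ z : ℂ, z ≠ 0 → DifferentiableAt ℂ g z := by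
    intro z₀ hz₀
    set R : ℝ := ‖z₀‖ + ‖z₀⁻¹‖ + 1 with hR
    have hR1 : 1 ≤ R := by have := norm_nonneg z₀; have := norm_nonneg z₀⁻¹; linarith
    set U : Set ℂ := {z | ‖z‖ < R ∧ R⁻¹ < ‖z‖} with hU
    have hUo : IsOpen U := (isOpen_lt continuous_norm continuous_const).inter
      (isOpen_lt continuous_const continuous_norm)
    have hUz : z₀ ∈ U := by
      refine ⟨by have := norm_nonneg z₀⁻¹; linarith, ?_⟩
      rw [inv_lt_comm₀ (by linarith) (norm_pos_iff.2 hz₀), ← norm_inv]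
      have := norm_nonneg z₀
      linarith
    have hne : ∀ z ∈ U, z ≠ 0 := by
      rintro z ⟨-, hz⟩ rfl
      rw [norm_zero] at hz
      exact absurd hz (not_lt.2 (by positivity))
    refine (Complex.differentiableOn_tsum_of_summable_norm (hterm R hR1).1 ?_ hUo ?_
      ).differentiableAt (hUo.mem_nhds hUz)
    · exact fun n => ((differentiableOn_jost W _).mono hne).mul_const _
    · intro n z hz
      refine (hterm R hR1).2 z hz.1.le ?_ n
      rw [norm_inv, inv_le_comm₀ (norm_pos_iff.2 (hne z hz)) (by linarith)]
      exact hz.2.le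
  have hgs : ∀ z : ℂ, z ≠ 0 → Summable fun n : ℕ => jost W z (n + 1) * f (n + 1) := by
    intro z hz
    have h1 := hterm (‖z‖ + ‖z⁻¹‖ + 1) (by have := norm_nonneg z; have := norm_nonneg z⁻¹; linarith)
    exact Summable.of_norm_bounded h1.1
      (h1.2 z (by have := norm_nonneg z⁻¹; linarith) (by have := norm_nonneg z; linarith))
  have hLs : ∀ w : ℂ, ‖w‖ < 1 → Summable fun n : ℕ => f (-n) * w ^ n := by
    intro w hw
    refine Summable.of_norm_bounded
      ((summable_geometric_of_lt_one (norm_nonneg w) hw).mul_left P) fun n => ?_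
    rw [norm_mul, norm_pow]
    gcongr
    exact hf _
  have hsplit : ∀ z : ℂ, z ≠ 0 → (Summable fun n : ℕ => f (-n) * z⁻¹ ^ n) →
      ∑' n, jost W z n * f n = L z⁻¹ + g z := by
    intro z hz hs
    have hleft : ∀ n : ℕ, jost W z (-n) * f (-n) = f (-n) * z⁻¹ ^ n := by
      intro n
      rw [jost_of_nonpos hW hz (by omega), zpow_neg, zpow_natCast, inv_pow, mul_comm]
    rw [← (Equiv.neg ℤ).tsum_eq]
    simp only [Equiv.neg_apply]
    rw [tsum_of_nat_of_neg_add_one]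
    · simp only [hleft, neg_neg, hL, hg]
    · simpa only [hleft] using hs
    · simpa only [neg_neg] using hgs z hz
  have hLg : ∀ w : ℂ, w ≠ 0 → ‖w‖ < 1 / 2 → L w = -g w⁻¹ := by
    intro w hw hw2
    have h1 := hsplit w⁻¹ (inv_ne_zero hw) (by rw [inv_inv]; exact hLs w (by linarith))
    rw [h w⁻¹ (by
      rw [norm_inv, lt_inv_comm₀ (by norm_num) (norm_pos_iff.2 hw)]
      linarith), inv_inv] at h1
    exact eq_neg_of_add_eq_zero_left h1.symm
  -- Gluing: `L` is holomorphic near 0, `-g w⁻¹` away from 0, and they agree on a punctured disc.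
  -- The glued function is entire with Taylor coefficients `f (-n)`.
  set E : ℂ → ℂ := Function.update (fun w => -g w⁻¹) 0 (f 0) with hE
  have hEL : ∀ w : ℂ, ‖w‖ < 1 / 2 → E w = L w := by
    intro w hw
    rcases eq_or_ne w 0 with rfl | hw0
    · simp only [hE, Function.update_self, hL]
      rw [tsum_eq_single 0 (fun n hn => by simp [hn])]
      simp
    · rw [hE, Function.update_of_ne hw0, hLg w hw0 hw]
  have hEd : Differentiable ℂ E := by
    intro w
    rcases eq_or_ne w 0 with rfl | hw0
    · have hLd : DifferentiableOn ℂ L (Metric.ball 0 (1 / 2)) := by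
        refine Complex.differentiableOn_tsum_of_summable_norm (u := fun n => P * (1 / 2) ^ n)
          ((summable_geometric_of_lt_one (by norm_num) (by norm_num)).mul_left P)
          (fun n => by fun_prop) Metric.isOpen_ball fun n w hw => ?_
        rw [norm_mul, norm_pow]
        have : ‖w‖ < 1 / 2 := by simpa using hw
        gcongr
        exact hf _
      refine (hLd.differentiableAt (Metric.ball_mem_nhds _ (by norm_num))).congr_of_eventuallyEq ?_
      filter_upwards [Metric.ball_mem_nhds (0 : ℂ) (show (0 : ℝ) < 1 / 2 by norm_num)] with w hw
      exact hEL w (by simpa using hw)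
    · have h1 : DifferentiableAt ℂ (fun w => -g w⁻¹) w :=
        ((hgd _ (inv_ne_zero hw0)).comp w (differentiableAt_inv hw0)).neg
      refine h1.congr_of_eventuallyEq ?_
      filter_upwards [isOpen_ne.mem_nhds hw0] with w hw
      rw [hE, Function.update_of_ne hw]
  set c : ℕ → ℂ := fun n => (n.factorial : ℂ)⁻¹ * iteratedDeriv n E 0 with hc
  have hEs : ∀ w, HasSum (fun n => c n * w ^ n) (E w) := by
    intro w
    refine (Complex.hasSum_taylorSeries_of_entire hEd 0 w).congr_fun fun n => ?_
    simp only [hc, sub_zero, smul_eq_mul]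
    ring
  have hcf : ∀ n : ℕ, f (-n) = c n := by
    intro n
    refine sub_eq_zero.1 (eq_zero_of_hasSum_pow_zero (a := fun n => f (-n) - c n)
      (r := 1 / 2) (by norm_num) (fun w hw => ?_) n)
    have := (hLs w (by linarith)).hasSum.sub (hEs w)
    rw [hEL w hw, sub_self] at this
    simpa only [sub_mul] using this
  have hEs' : ∀ w, HasSum (fun n : ℕ => f (-n) * w ^ n) (E w) := by
    simpa only [hcf] using hEs
  constructor
  · intro R hR
    have := (hEs' R).summable.norm
    simpa [abs_of_nonneg (zero_le_one.trans hR)] using this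
  · intro z hz
    rw [hsplit z hz (hEs' _).summable]
    have h1 : L z⁻¹ = E z⁻¹ := (hEs' _).tsum_eq
    rw [h1, hE, Function.update_of_ne (inv_ne_zero hz), inv_inv, neg_add_cancel]

/-! ### Completeness of the eigenfunctions via polynomials in the Jacobi operator. -/

section

open Polynomial

/-- If an absolutely convergent series of polynomials vanishes near the origin, then so does its
image under any functional on polynomials of geometric growth. -/
theorem hasSum_functional_eq_zero {p : ℤ → ℂ[X]} {f : ℤ → ℂ} {R : ℝ} (hR : 1 ≤ R) {N : ℤ → ℝ}
    (hp : ∀ n K, ∑ k ∈ Finset.range K, ‖(p n).coeff k‖ * R ^ k ≤ N n)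
    (hN : Summable fun n => ‖f n‖ * N n)
    (h : ∀ μ : ℂ, ‖μ‖ < 1 → ∑' n, f n * (p n).eval μ = 0) {m : ℕ → ℂ} {D : ℝ}
    (hm : ∀ k, ‖m k‖ ≤ D * R ^ k) :
    HasSum (fun n => f n * ∑ k ∈ Finset.range ((p n).natDegree + 1), (p n).coeff k * m k) 0 := by
  have hR0 : 0 ≤ R := by linarith
  -- Absolute convergence of the double series permits summing over `n` first, where each
  -- coefficient of `μ ^ k` vanishes.
  have hs0 : Summable fun x : ℤ × ℕ => ‖f x.1‖ * (‖(p x.1).coeff x.2‖ * R ^ x.2) := by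
    refine (summable_prod_of_nonneg fun x => by positivity).2 ⟨fun n => ?_, ?_⟩
    · exact (summable_of_sum_range_le (f := fun k => ‖(p n).coeff k‖ * R ^ k)
        (fun k => by positivity) (hp n)).mul_left ‖f n‖
    · refine Summable.of_nonneg_of_le (fun n => tsum_nonneg fun k => by positivity) (fun n => ?_) hN
      change ∑' k, ‖f n‖ * (‖(p n).coeff k‖ * R ^ k) ≤ _
      rw [tsum_mul_left]
      gcongr
      exact Real.tsum_le_of_sum_range_le (fun k => by positivity) (hp n)
  have hs : ∀ {m : ℕ → ℂ} {D : ℝ}, (∀ k, ‖m k‖ ≤ D * R ^ k) →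
      Summable (Function.uncurry fun (n : ℤ) (k : ℕ) => f n * ((p n).coeff k * m k)) := by
    intro m D hm
    refine Summable.of_norm_bounded (hs0.mul_left D) fun x => ?_
    simp only [Function.uncurry, norm_mul]
    calc ‖f x.1‖ * (‖(p x.1).coeff x.2‖ * ‖m x.2‖)
        ≤ ‖f x.1‖ * (‖(p x.1).coeff x.2‖ * (D * R ^ x.2)) := by gcongr; exact hm _
      _ = _ := by ring
  have hfin : ∀ (m : ℕ → ℂ) (n : ℤ), ∑' k, f n * ((p n).coeff k * m k) =
      f n * ∑ k ∈ Finset.range ((p n).natDegree + 1), (p n).coeff k * m k := by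
    intro m n
    rw [tsum_mul_left, tsum_eq_sum fun k hk => ?_]
    rw [coeff_eq_zero_of_natDegree_lt (by simpa using hk), zero_mul]
  have hcoeff : ∀ k, ∑' n, f n * (p n).coeff k = 0 := by
    refine fun k => eq_zero_of_hasSum_pow_zero (a := fun k => ∑' n, f n * (p n).coeff k)
      one_pos (fun μ hμ => ?_) k
    have hsμ := hs (m := fun k => μ ^ k) (D := 1) fun k => by
      rw [norm_pow, one_mul]
      exact pow_le_pow_left₀ (norm_nonneg _) (hμ.le.trans hR) k
    have h2 := hsμ.prod_symm.prod.hasSum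
    simp only [Prod.swap_prod_mk, Function.uncurry_apply_pair] at h2
    rw [hsμ.tsum_comm] at h2
    simp only [hfin, ← eval_eq_sum_range, h μ hμ] at h2
    simpa only [← mul_assoc, tsum_mul_right] using h2
  have h3 := (hs hm).prod.hasSum
  simp only [Function.uncurry_apply_pair] at h3
  rw [← (hs hm).tsum_comm] at h3
  simp only [hfin] at h3
  simpa only [← mul_assoc, tsum_mul_right, hcoeff, zero_mul, tsum_zero] using h3

/-- In the weighted `ℓ¹` norm of coefficients, multiplication by `X` costs `R` and by `W n` costs
`B`. Truncation at `K` keeps the sums finite, with a bound uniform in `K`. -/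
theorem sum_coeff_recSol_le {W : ℤ → ℝ} {B R : ℝ} (hB : ∀ n, |W n| ≤ B) (hR : 1 ≤ R)
    {a b : ℂ} (ha : ‖a‖ ≤ 1) (hb : ‖b‖ ≤ 1) (n : ℤ) (K : ℕ) :
    ∑ k ∈ Finset.range K,
      ‖(recSol (fun n => (X : ℂ[X]) - C (W n : ℂ)) (C a) (C b) n).coeff k‖ * R ^ k ≤
      (R + B + 1) ^ n.natAbs := by
  have hR0 : 0 ≤ R := by linarith
  have hB0 : 0 ≤ B := (abs_nonneg _).trans (hB 0)
  have hC : ∀ c : ℂ, ‖c‖ ≤ 1 → ∑ k ∈ Finset.range K, ‖(C c).coeff k‖ * R ^ k ≤ 1 := by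
    intro c hc
    rcases K with - | K
    · simp
    · rw [Finset.sum_range_succ']
      simpa [coeff_C_succ] using hc
  have := recSol_bound (ν := fun n => (X : ℂ[X]) - C (W n : ℂ)) (a := C a) (b := C b)
    (N := fun p => ∑ k ∈ Finset.range K, ‖p.coeff k‖ * R ^ k) (L := R + B) (P := 1)
    (by positivity) zero_le_one ?_ ?_ (hC a ha) (hC b hb) n
  · simpa using this
  · intro p q
    rw [← Finset.sum_add_distrib]
    refine Finset.sum_le_sum fun k _ => ?_
    rw [coeff_sub, ← add_mul]
    gcongr
    exact norm_sub_le _ _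
  · intro n p
    have hX : ∑ k ∈ Finset.range K, ‖((X : ℂ[X]) * p).coeff k‖ * R ^ k ≤
        R * ∑ k ∈ Finset.range K, ‖p.coeff k‖ * R ^ k := by
      rcases K with - | K
      · simp
      · rw [Finset.sum_range_succ', Finset.mul_sum]
        simp only [coeff_X_mul, coeff_X_mul_zero, norm_zero, zero_mul, add_zero]
        rw [Finset.sum_range_succ]
        refine le_add_of_le_of_nonneg (le_of_eq (Finset.sum_congr rfl fun k _ => ?_)) (by positivity)
        ring
    calc ∑ k ∈ Finset.range K, ‖((X - C (W n : ℂ)) * p).coeff k‖ * R ^ k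
        ≤ ∑ k ∈ Finset.range K, (‖((X : ℂ[X]) * p).coeff k‖ * R ^ k +
            B * (‖p.coeff k‖ * R ^ k)) := by
          refine Finset.sum_le_sum fun k _ => ?_
          rw [sub_mul, coeff_sub, coeff_C_mul, ← mul_assoc, ← add_mul]
          gcongr
          refine (norm_sub_le _ _).trans ?_
          rw [norm_mul, Complex.norm_real]
          gcongr
          exact hB n
      _ ≤ R * ∑ k ∈ Finset.range K, ‖p.coeff k‖ * R ^ k +
            B * ∑ k ∈ Finset.range K, ‖p.coeff k‖ * R ^ k := by
          rw [Finset.sum_add_distrib, ← Finset.mul_sum (a := B)]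
          gcongr
      _ = _ := by ring

/-- The Jacobi operator `g ↦ g (n + 1) + g (n - 1) + W n * g n` on all functions. -/
def jacobiEnd (W : ℤ → ℝ) : Module.End ℂ (ℤ → ℂ) where
  toFun g n := g (n + 1) + g (n - 1) + W n * g n
  map_add' g h := by ext n; simp only [Pi.add_apply]; ring
  map_smul' c g := by ext n; simp only [Pi.smul_apply, smul_eq_mul, RingHom.id_apply]; ring

theorem jacobiEnd_apply (W : ℤ → ℝ) (g : ℤ → ℂ) (n : ℤ) :
    jacobiEnd W g n = g (n + 1) + g (n - 1) + W n * g n := rfl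

theorem norm_jacobiEnd_pow_le {W : ℤ → ℝ} {B : ℝ} (hB : ∀ n, |W n| ≤ B) {g : ℤ → ℂ}
    (hg : ∀ n, ‖g n‖ ≤ 1) (k : ℕ) (n : ℤ) : ‖(jacobiEnd W ^ k) g n‖ ≤ (2 + B) ^ k := by
  have hB0 : 0 ≤ B := (abs_nonneg _).trans (hB 0)
  induction k generalizing n with
  | zero => simpa using hg n
  | succ k ih =>
    rw [pow_succ', Module.End.mul_apply, jacobiEnd_apply]
    calc _ ≤ (2 + B) ^ k + (2 + B) ^ k + B * (2 + B) ^ k := by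
          refine (norm_add_le _ _).trans (add_le_add ((norm_add_le _ _).trans
            (add_le_add (ih _) (ih _))) ?_)
          rw [norm_mul, Complex.norm_real]
          gcongr
          exacts [hB n, ih n]
      _ = _ := by ring

/-- The delta functions are polynomials in the Jacobi operator applied to two of them. -/
theorem aeval_jacobiEnd_recSol (W : ℤ → ℝ) (n : ℤ) :
    aeval (jacobiEnd W) (recSol (fun n => (X : ℂ[X]) - C (W n : ℂ)) (C 0) (C 1) n)
        (Pi.single 0 1) +
      aeval (jacobiEnd W) (recSol (fun n => (X : ℂ[X]) - C (W n : ℂ)) (C 1) (C 0) n)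
        (Pi.single (-1) 1) = Pi.single n 1 := by
  -- By symmetry of the operator, `J δₙ = δₙ₊₁ + δₙ₋₁ + W n δₙ`: the delta functions satisfy the
  -- polynomial recursion with `X` replaced by `J`.
  refine eq_of_two_step (F := fun n x => jacobiEnd W x - (W n : ℂ) • x)
    (x := fun n => aeval (jacobiEnd W) (recSol (fun n => (X : ℂ[X]) - C (W n : ℂ)) (C 0) (C 1) n)
        (Pi.single 0 1) +
      aeval (jacobiEnd W) (recSol (fun n => (X : ℂ[X]) - C (W n : ℂ)) (C 1) (C 0) n)
        (Pi.single (-1) 1)) (y := fun n => Pi.single n 1) ?_ ?_ ?_ ?_ n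
  · intro n
    have h : ∀ a b : ℂ[X], ∀ g : ℤ → ℂ,
        aeval (jacobiEnd W) (recSol (fun n => (X : ℂ[X]) - C (W n : ℂ)) a b (n + 1)) g +
          aeval (jacobiEnd W) (recSol (fun n => (X : ℂ[X]) - C (W n : ℂ)) a b (n - 1)) g =
        jacobiEnd W (aeval (jacobiEnd W) (recSol (fun n => (X : ℂ[X]) - C (W n : ℂ)) a b n) g) -
          (W n : ℂ) • aeval (jacobiEnd W) (recSol (fun n => (X : ℂ[X]) - C (W n : ℂ)) a b n) g := by
      intro a b g
      rw [← LinearMap.add_apply, ← map_add, recSol_rec, map_mul, map_sub, aeval_X, aeval_C,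
        Module.End.mul_apply, LinearMap.sub_apply, Module.algebraMap_end_apply]
    rw [map_add, smul_add, add_add_add_comm, h, h]
    abel
  · intro n
    ext m
    simp only [Pi.add_apply, Pi.sub_apply, Pi.smul_apply, jacobiEnd_apply, smul_eq_mul,
      Pi.single_apply]
    have e1 : (m + 1 = n) ↔ (m = n - 1) := by omega
    have e2 : (m - 1 = n) ↔ (m = n + 1) := by omega
    simp only [e1, e2]
    by_cases hmn : m = n
    · subst hmn; ring
    · simp only [hmn, if_false]; ring
  · simp [recSol_zero]
  · simp [recSol_neg_one]

/-- A superexponentially decaying sequence orthogonal to all Jost solutions vanishes. -/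
theorem eq_zero_of_tsum_jost_eq_zero {W : ℤ → ℝ} {f : ℤ → ℂ} {B : ℝ} (hB : ∀ n, |W n| ≤ B)
    (hf : ∀ R : ℝ, 1 ≤ R → Summable fun n : ℤ => ‖f n‖ * R ^ n.natAbs)
    (h : ∀ z : ℂ, z ≠ 0 → ∑' n, jost W z n * f n = 0) (m : ℤ) : f m = 0 := by
  have hB0 : 0 ≤ B := (abs_nonneg _).trans (hB 0)
  set p : ℤ → ℂ[X] := fun n => recSol (fun n => (X : ℂ[X]) - C (W n : ℂ)) (C 0) (C 1) n with hp
  set q : ℤ → ℂ[X] := fun n => recSol (fun n => (X : ℂ[X]) - C (W n : ℂ)) (C 1) (C 0) n with hq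
  -- This bounds the Jacobi operator in the sup norm, so the moments `(J ^ k δ)(m)` grow at most
  -- like `R ^ k`.
  set R : ℝ := 2 + B with hR
  have hR1 : 1 ≤ R := by linarith
  have hpb := fun n K => sum_coeff_recSol_le hB hR1 (a := 0) (b := 1) (by simp) (by simp) n K
  have hqb := fun n K => sum_coeff_recSol_le hB hR1 (a := 1) (b := 0) (by simp) (by simp) n K
  have hsum := hf (R + B + 1) (by linarith)
  have heval : ∀ (p : ℂ[X]) (μ : ℂ), ‖μ‖ < 1 → ∀ {b : ℝ},
      (∀ K, ∑ k ∈ Finset.range K, ‖p.coeff k‖ * R ^ k ≤ b) → ‖p.eval μ‖ ≤ b := by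
    intro p μ hμ b hb
    rw [eval_eq_sum_range]
    refine (norm_sum_le _ _).trans ((Finset.sum_le_sum fun k _ => ?_).trans (hb _))
    rw [norm_mul, norm_pow]
    gcongr
    linarith
  have hps : ∀ μ : ℂ, ‖μ‖ < 1 → Summable fun n => f n * (p n).eval μ := fun μ hμ =>
    Summable.of_norm_bounded hsum fun n => by
      rw [norm_mul]
      gcongr
      exact heval _ μ hμ (hpb n)
  have hqs : ∀ μ : ℂ, ‖μ‖ < 1 → Summable fun n => f n * (q n).eval μ := fun μ hμ =>
    Summable.of_norm_bounded hsum fun n => by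
      rw [norm_mul]
      gcongr
      exact heval _ μ hμ (hqb n)
  have hjost : ∀ z : ℂ, ∀ n, jost W z n =
      (p n).eval (z + z⁻¹) + z⁻¹ * (q n).eval (z + z⁻¹) := by
    intro z
    refine eq_of_two_step (F := fun n x => (z + z⁻¹ - W n) * x) (jost_rec W z) (fun n => ?_) ?_ ?_
    · have h1 := congrArg (eval (z + z⁻¹))
        (recSol_rec (fun n => (X : ℂ[X]) - C (W n : ℂ)) (C 0) (C 1) n)
      have h2 := congrArg (eval (z + z⁻¹))
        (recSol_rec (fun n => (X : ℂ[X]) - C (W n : ℂ)) (C 1) (C 0) n)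
      simp only [eval_add, eval_mul, eval_sub, eval_X, eval_C] at h1 h2
      simp only [hp, hq]
      linear_combination h1 + z⁻¹ * h2
    · simp [hp, hq, recSol_zero, jost]
    · simp [hp, hq, recSol_neg_one, jost]
  have hpair : ∀ z : ℂ, z ≠ 0 → ‖z + z⁻¹‖ < 1 →
      ∑' n, f n * (p n).eval (z + z⁻¹) + z⁻¹ * ∑' n, f n * (q n).eval (z + z⁻¹) = 0 := by
    intro z hz hμ
    rw [← tsum_mul_left, ← (hps _ hμ).tsum_add ((hqs _ hμ).mul_left _), ← h z hz]
    refine tsum_congr fun n => ?_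
    rw [hjost]
    ring
  have hboth : ∀ μ : ℂ, ‖μ‖ < 1 →
      ∑' n, f n * (p n).eval μ = 0 ∧ ∑' n, f n * (q n).eval μ = 0 := by
    intro μ hμ
    -- The numbers `(μ ± s) / 2` are `z` and `z⁻¹` with `z + z⁻¹ = μ`. They differ because `|μ| < 1`
    -- avoids `μ = ±2`, so the two relations separate the sums over `p` and `q`.
    obtain ⟨s, hs⟩ := IsAlgClosed.exists_pow_nat_eq (μ ^ 2 - 4) two_pos
    have hprod : (μ + s) / 2 * ((μ - s) / 2) = 1 := by linear_combination -hs / 4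
    have hz0 : (μ + s) / 2 ≠ 0 := left_ne_zero_of_mul_eq_one hprod
    have hinv : ((μ + s) / 2)⁻¹ = (μ - s) / 2 := inv_eq_of_mul_eq_one_right hprod
    have hinv' : ((μ - s) / 2)⁻¹ = (μ + s) / 2 := inv_eq_of_mul_eq_one_left hprod
    have hadd : (μ + s) / 2 + (μ - s) / 2 = μ := by ring
    have hadd' : (μ - s) / 2 + (μ + s) / 2 = μ := by ring
    have h1 := hpair _ hz0 (by rw [hinv, hadd]; exact hμ)
    have h2 := hpair _ (right_ne_zero_of_mul_eq_one hprod) (by rw [hinv', hadd']; exact hμ)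
    rw [hinv, hadd] at h1
    rw [hinv', hadd'] at h2
    have hs0 : s ≠ 0 := by
      rintro rfl
      have : μ ^ 2 = 4 := by linear_combination -hs
      have h4 : ‖μ‖ ^ 2 = 4 := by rw [← norm_pow, this]; norm_num
      nlinarith [norm_nonneg μ]
    have hq0 : ∑' n, f n * (q n).eval μ = 0 := by
      have : s * ∑' n, f n * (q n).eval μ = 0 := by linear_combination h2 - h1
      exact (mul_eq_zero.1 this).resolve_left hs0
    exact ⟨by simpa [hq0] using h1, hq0⟩
  have hone : ∀ j : ℤ, ∀ n, ‖(Pi.single j 1 : ℤ → ℂ) n‖ ≤ 1 := by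
    intro j n
    rw [Pi.single_apply]
    split_ifs <;> simp
  have hP := hasSum_functional_eq_zero hR1 hpb hsum (fun μ hμ => (hboth μ hμ).1) (D := 1)
    (m := fun k => (jacobiEnd W ^ k) (Pi.single 0 1) m) fun k => by
      rw [one_mul]
      exact norm_jacobiEnd_pow_le hB (hone 0) k m
  have hQ := hasSum_functional_eq_zero hR1 hqb hsum (fun μ hμ => (hboth μ hμ).2) (D := 1)
    (m := fun k => (jacobiEnd W ^ k) (Pi.single (-1) 1) m) fun k => by
      rw [one_mul]
      exact norm_jacobiEnd_pow_le hB (hone (-1)) k m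
  have hae : ∀ (p : ℂ[X]) (g : ℤ → ℂ), ∑ k ∈ Finset.range (p.natDegree + 1),
      p.coeff k * (jacobiEnd W ^ k) g m = aeval (jacobiEnd W) p g m := by
    intro p g
    rw [aeval_eq_sum_range, LinearMap.sum_apply, Finset.sum_apply]
    rfl
  simp only [hae] at hP hQ
  have hsumm := hP.add hQ
  simp only [← mul_add, ← Pi.add_apply, aeval_jacobiEnd_recSol] at hsumm
  have h5 := hsumm.unique (hasSum_single m fun n hn => by
    rw [Pi.single_apply, if_neg hn.symm, mul_zero])
  simpa using h5.symm

end

/-! ### Conclusion. -/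

theorem theorem2 (V : ℤ → ℝ) (hV : {n : ℤ | V n ≠ 0}.Finite)
    (u : ℝ → lp (fun _ : ℤ => ℂ) 2) (hu : IsStrongSolution (fun _ => V) u)
    (ε : ℝ) (hε : 0 < ε) (C : ℝ)
    (hdecay : ∀ t ∈ ({0, 1} : Set ℝ), ∀ n : ℕ, 0 < n →
      ‖u t (n : ℤ)‖ ≤ C * (Real.exp 1 / ((2 + ε) * (n : ℝ))) ^ n) :
    ∀ t : ℝ, 0 ≤ t → ∀ n : ℤ, u t n = 0 := by
  obtain ⟨M, hM⟩ := hV.bddBelow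
  have hVM : ∀ n < M, V n = 0 := fun n hn => by
    by_contra h
    exact absurd (hM h) (not_le.2 hn)
  have hVs : Summable fun n => |V n| :=
    summable_of_hasFiniteSupport (hV.subset fun n hn => by simpa using hn)
  have hVB : ∀ n, |V n| ≤ ∑' n, |V n| := fun n => hVs.le_tsum n fun _ _ => abs_nonneg _
  have hVs' : Summable fun n : ℕ => |V (n + M)| :=
    hVs.comp_injective (i := fun n : ℕ => (n : ℤ) + M) fun a b h => by simpa using h
  obtain ⟨a, q, -, -, hq0, hq1, haq⟩ := exists_type_lt_half hε
  have hqs : Summable fun n : ℤ => q ^ n.natAbs :=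
    Summable.of_nat_of_neg (by simpa using summable_geometric_of_lt_one hq0 hq1)
      (by simpa using summable_geometric_of_lt_one hq0 hq1)
  set W : ℤ → ℝ := fun j => V (j + M) with hW
  set f : ℤ → ℂ := fun j => u 0 (j + M) with hf
  have hright : ∀ R : ℝ, 1 ≤ R → Summable fun n : ℕ => ‖f n‖ * R ^ n := by
    intro R hR
    -- The type estimate requires radius at least 2.
    set r : ℝ := max R 2 with hr
    have hr2 : 2 ≤ r := le_max_right _ _
    have hr0 : r ≠ 0 := by linarith
    have h1 := hqs.comp_injective (i := fun n : ℕ => (n : ℤ) + M) fun a b h => by simpa using h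
    refine Summable.of_nonneg_of_le (fun n => by positivity) (fun n => ?_)
      (h1.mul_left ((|C| + ‖u 0‖) * Real.exp (a * r) * r ^ (-M)))
    have h2 := haq (fun n => u 0 n) ‖u 0‖ C (fun n => lp.norm_apply_le_norm two_ne_zero _ n)
      (hdecay 0 (by simp)) r hr2 (n + M)
    calc ‖f n‖ * R ^ n ≤ ‖f n‖ * r ^ n := by gcongr; exact le_max_left _ _
      _ = ‖u 0 (n + M)‖ * r ^ ((n : ℤ) + M) * r ^ (-M) := by
          rw [mul_assoc, ← zpow_add₀ hr0, add_neg_cancel_right, zpow_natCast]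
      _ ≤ (|C| + ‖u 0‖) * q ^ ((n : ℤ) + M).natAbs * Real.exp (a * r) * r ^ (-M) :=
          mul_le_mul_of_nonneg_right h2 (by positivity)
      _ = _ := by simp only [Function.comp_apply]; ring
  obtain ⟨hleft, horth⟩ := left_decay_of_tsum_jost_eq_zero (W := W) (f := f)
    (fun n hn => hVM _ (by omega)) (fun n => hVB _)
    (fun n => lp.norm_apply_le_norm two_ne_zero (u 0) _) hright fun z hz => by
      have := tsum_jost_mul_eq_zero hVM (fun n => hVs'.sum_le_tsum _ fun _ _ => abs_nonneg _)
        hVB hu hε hdecay z hz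
      rw [← (Equiv.addRight M).tsum_eq] at this
      simpa only [Equiv.coe_addRight, add_sub_cancel_right] using this
  have hzero := eq_zero_of_tsum_jost_eq_zero (fun n => hVB (n + M)) (fun R hR =>
    Summable.of_nat_of_neg (by simpa using hright R hR) (by simpa using hleft R hR)) horth
  intro t ht n
  refine hu.eq_zero hVB (fun n => ?_) ht n
  simpa [hf] using hzero (n - M)
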